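/- Let $n,m,k,D\ge 0$ and $d\ge 1$ be integers, let $f(x;p)$ be a system of $k$ polynomials in $x\in\mathbb C^n$ and the parameters $p\in\mathbb C^m$, and let $A\subset V(f(x,p))\subset\mathbb C^n\times\mathbb C^m$ be an irreducible algebraic set, with fibers $A_p=\{x\mid (x,p)\in A\}$. For $c\in\mathbb C^{D\times(n+1)}$ let $L_c:\mathbb C^n\to\mathbb C^D$ be the system of $D$ affine linear polynomials with coefficients $c$. Consider the component system $$F_c(x_1,\dots,x_d,p)=\bigl[f(x_1;p),\,L_c(x_1),\,\dots,\,f(x_d;p),\,L_c(x_d)\bigr],$$ in which all $d$ copies share the same $c$. For $a\ge 0$, constants $c=(c_1,\dots,c_a)$ and $X_j=(x_{j1},\dots,x_{jd})\in(\mathbb C^n)^d$, consider the fiber product system $\mathcal F_a(X_1,\dots,X_a,p)=[F_{c_1}(X_1,p),\dots,F_{c_a}(X_a,p)]$ and the projection $\pi_a(X_1,\dots,X_a,p)=p$. Let $V_A(\mathcal F_a)$ be the set of solutions with $(x_{ji},p)\in A$ for all $j,i$. For all $a$ and all $c$ let $\Delta_a=\Delta_a(c)\subset V(\mathcal F_a)$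 be sets to be ignored such that * for each $a$, the set $\Delta_a$ is algebraic, defined by polynomials in $X_1,\dots,X_a,p$ and the constants $c$; * (natural inclusion) if $j_1<\dots<j_a$ are among $1,\dots,b$ and a solution of $\mathcal F_b$ is such that its sub-tuple $(X_{j_1},\dots,X_{j_a},p)$ lies in $\Delta_a(c_{j_1},\dots,c_{j_a})$, then it lies in $\Delta_b$; * (consistency) if $(X_1,\dots,X_{a+1},p)\in\Delta_{a+1}$, then $(X_1,\dots,X_a,p)\in\Delta_a$, or $(X_{a+1},p)\in\Delta_1(c_{a+1})$, or $D>0$ and $X_{a+1}=X_j$ for some $j\le a$. For instance, all $\Delta_a$ may be empty, or they may consist of the solutions with $x_{ji}=x_{ji'}$ for some $j$ and some $i\ne i'$, or (if $D>0$) of the solutions with $X_j=X_{j'}$ for some $j\neq j'$. "Generic" means outside a proper algebraic subset of the space of the constants, and $\dim\emptyset=-\infty$. Then for each $a\ge 0$ the number $e_a=\dim\overline{\pi_a(V_A(\mathcal F_a)\setminus\Delta_a)}$ is the same for all generic $(c_1,\dots,c_a)$, and for each $a\ge0$ exactly one of the following holds: 1. $e_a>e_{a+1}$, or 2. $e_a=e_j$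 for all $j\ge a$. Suppose moreover that $\Delta_1$ contains all solutions of $F_{c}$ in which two of the points $x_1,\dots,x_d$ coincide, and that $e_a=e_{a+1}\neq-\infty$. Then for generic $(c_1,\dots,c_{a+1})$ and all $p\in\pi_{a+1}(V_A(\mathcal F_{a+1})\setminus\Delta_{a+1})$ outside a subset whose closure has dimension less than $e_{a+1}$, the following holds: $\dim A_p\ge D$, and the union of the irreducible components of $A_p$ of dimension at least $D$ has at least $d$ distinct points on $V(L_c)$ for generic $c$. In particular, if $\dim A_p=D$, then the $D$-dimensional part of $A_p$ has degree at least $d$. -/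

import Mathlib

open MvPolynomial

noncomputable section

namespace FiberProd

/-! ### Affine algebraic sets over the complex numbers -/

/-- A (Zariski closed) algebraic subset of the affine space with coordinates indexed by `σ`. -/
def IsAlgebraicSet {σ : Type*} (S : Set (σ → ℂ)) : Prop :=
  ∃ I : Ideal (MvPolynomial σ ℂ), S = zeroLocus ℂ I

/-- A nonempty algebraic set that is not the union of two smaller algebraic sets. -/
def IsIrreducibleAlgebraicSet {σ : Type*} (S : Set (σ → ℂ)) : Prop :=
  IsAlgebraicSet S ∧ S.Nonempty ∧
    ∀ B C : Set (σ → ℂ), IsAlgebraicSet B → IsAlgebraicSet C → S ⊆ B ∪ C → S ⊆ B ∨ S ⊆ C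

/-- The Zariski closure of a set. -/
def zariskiClosure {σ : Type*} (S : Set (σ → ℂ)) : Set (σ → ℂ) :=
  zeroLocus ℂ (vanishingIdeal ℂ S)

/-- The dimension of an algebraic set: the Krull dimension of its coordinate ring.
The empty set has dimension `⊥`. -/
def algDim {σ : Type*} (X : Set (σ → ℂ)) : WithBot ℕ∞ :=
  ringKrullDim (MvPolynomial σ ℂ ⧸ vanishingIdeal ℂ X)

/-- `P` holds for generic points: the exceptions lie in a proper algebraic subset. -/
def Generic {σ : Type*} (P : (σ → ℂ) → Prop) : Prop :=
  ∃ E : Set (σ → ℂ), IsAlgebraicSet E ∧ E ≠ Set.univ ∧ ∀ z, z ∉ E → P z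

/-- `Y` is an irreducible component of `X`: a maximal irreducible algebraic subset. -/
def IsIrredComponent {σ : Type*} (Y X : Set (σ → ℂ)) : Prop :=
  IsIrreducibleAlgebraicSet Y ∧ Y ⊆ X ∧
    ∀ Y' : Set (σ → ℂ), IsIrreducibleAlgebraicSet Y' → Y ⊆ Y' → Y' ⊆ X → Y' = Y

/-- The union of the irreducible components of `X` of dimension at least `D`. -/
def partOfDimGE {σ : Type*} (D : ℕ) (X : Set (σ → ℂ)) : Set (σ → ℂ) :=
  {x | ∃ Y, IsIrredComponent Y X ∧ (D : WithBot ℕ∞) ≤ algDim Y ∧ x ∈ Y}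

/-! ### Slices and the component system -/

/-- Indices of the coefficients of `D` affine linear polynomials in `n` variables: `(l, some t)`
is the coefficient of `x_t` and `(l, none)` the constant term of the `l`-th polynomial. -/
abbrev SliceVar (n D : ℕ) : Type := Fin D × Option (Fin n)

/-- The slicing system `L_c : ℂⁿ → ℂᴰ` with coefficients `c`. -/
def slice {n D : ℕ} (c : SliceVar n D → ℂ) (l : Fin D) : MvPolynomial (Fin n) ℂ :=
  (∑ t : Fin n, C (c (l, some t)) * X t) + C (c (l, none))

/-- The zero set of the slicing system. -/
def sliceZeros {n D : ℕ} (c : SliceVar n D → ℂ) : Set (Fin n → ℂ) :=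
  {x | ∀ l, eval x (slice c l) = 0}

/-- The component system `F_c(x_1, …, x_d, p)`, consisting of `f(x_i; p)` and `L_c(x_i)` for
`i = 1, …, d`; all the copies share the same `c`. The variable `inl (i, t)` is the `t`-th
coordinate of `x_i`, and `inr q` is the `q`-th parameter. -/
def componentSystem {n m k D : ℕ} (d : ℕ) (f : Fin k → MvPolynomial (Fin n ⊕ Fin m) ℂ)
    (c : SliceVar n D → ℂ) :
    Fin d × (Fin k ⊕ Fin D) → MvPolynomial ((Fin d × Fin n) ⊕ Fin m) ℂ
  | (i, Sum.inl s) => rename (Sum.map (fun t => (i, t)) id) (f s)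
  | (i, Sum.inr l) => rename (fun t => Sum.inl (i, t)) (slice c l)

/-! ### The fiber product systems -/

/-- Coordinates for `(X_1, …, X_a, p)` where each `X_j = (x_{j1}, …, x_{jd})` is a `d`-tuple of
points of `ℂⁿ` and `p ∈ ℂᵐ`. -/
abbrev TupleVar (n m d a : ℕ) : Type := (Fin a × Fin d × Fin n) ⊕ Fin m

/-- The fiber product system `𝓕_a`: `F_{c_1}(X_1, p), …, F_{c_a}(X_a, p)`, the constants being
`c_j = (c (j, ·))`. -/
def fiberSystem {n m k D : ℕ} (d : ℕ) (f : Fin k → MvPolynomial (Fin n ⊕ Fin m) ℂ) (a : ℕ)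
    (c : Fin a × SliceVar n D → ℂ) :
    Fin a × Fin d × (Fin k ⊕ Fin D) → MvPolynomial (TupleVar n m d a) ℂ :=
  fun u => rename (Sum.map (Prod.mk u.1) id) (componentSystem d f (fun v => c (u.1, v)) u.2)

/-- `V(𝓕_a)`. -/
def fiberZeros {n m k D : ℕ} (d : ℕ) (f : Fin k → MvPolynomial (Fin n ⊕ Fin m) ℂ) (a : ℕ)
    (c : Fin a × SliceVar n D → ℂ) : Set (TupleVar n m d a → ℂ) :=
  {z | ∀ u, eval z (fiberSystem d f a c u) = 0}

/-- `V_A(𝓕_a)`: the solutions with `(x_{ji}, p) ∈ A` for all `j` and `i`. -/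
def fiberZerosIn {n m k D : ℕ} (d : ℕ) (f : Fin k → MvPolynomial (Fin n ⊕ Fin m) ℂ)
    (A : Set (Fin n ⊕ Fin m → ℂ)) (a : ℕ) (c : Fin a × SliceVar n D → ℂ) :
    Set (TupleVar n m d a → ℂ) :=
  {z | z ∈ fiberZeros d f a c ∧
    ∀ (j : Fin a) (i : Fin d), (fun v => z (Sum.map (fun t => (j, i, t)) id v)) ∈ A}

/-- The projection `π_a` onto the parameters. -/
def toParam {n m d a : ℕ} (z : TupleVar n m d a → ℂ) : Fin m → ℂ := fun q => z (Sum.inr q)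

/-- The sub-tuple formed by the copies number `φ 1, …, φ a`, with the same parameters. -/
def subTuple {n m d a b : ℕ} (φ : Fin a → Fin b) (z : TupleVar n m d b → ℂ) :
    TupleVar n m d a → ℂ :=
  fun v => z (Sum.map (Prod.map φ id) id v)

/-- The constants of the copies number `φ 1, …, φ a`. -/
def subConst {n D a b : ℕ} (φ : Fin a → Fin b) (c : Fin b × SliceVar n D → ℂ) :
    Fin a × SliceVar n D → ℂ :=
  fun v => c (Prod.map φ id v)

/-- A consistent family of components to ignore: `Δ a c ⊆ V(𝓕_a)` for all `a` and all constants
`c`. -/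
structure IsIgnorable {n m k D : ℕ} (d : ℕ) (f : Fin k → MvPolynomial (Fin n ⊕ Fin m) ℂ)
    (Δ : (a : ℕ) → (Fin a × SliceVar n D → ℂ) → Set (TupleVar n m d a → ℂ)) : Prop where
  /-- It is contained in the solution set. -/
  subset : ∀ a c, Δ a c ⊆ fiberZeros d f a c
  /-- It is an algebraic set, defined by polynomials in the unknowns and the constants. -/
  algebraic : ∀ a, IsAlgebraicSet {w : (Fin a × SliceVar n D) ⊕ TupleVar n m d a → ℂ |
    (fun v => w (Sum.inr v)) ∈ Δ a (fun v => w (Sum.inl v))}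
  /-- A solution with an ignored sub-tuple is ignored. -/
  natural : ∀ {a b : ℕ} (φ : Fin a ↪o Fin b) (c : Fin b × SliceVar n D → ℂ)
    (z : TupleVar n m d b → ℂ), z ∈ fiberZeros d f b c →
      subTuple φ z ∈ Δ a (subConst φ c) → z ∈ Δ b c
  /-- Appending a copy to a tuple that is not ignored gives an ignored tuple only if the new copy
  is ignored by itself or, when there are slices, coincides with an earlier copy. -/
  consistent : ∀ (a : ℕ) (c : Fin (a + 1) × SliceVar n D → ℂ)
    (z : TupleVar n m d (a + 1) → ℂ), z ∈ Δ (a + 1) c →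
      subTuple Fin.castSucc z ∈ Δ a (subConst Fin.castSucc c) ∨
      subTuple (fun _ : Fin 1 => Fin.last a) z ∈ Δ 1 (subConst (fun _ => Fin.last a) c) ∨
      (0 < D ∧ ∃ j : Fin a, ∀ (i : Fin d) (t : Fin n),
        z (Sum.inl (Fin.last a, i, t)) = z (Sum.inl (j.castSucc, i, t)))

/-- `Δ` ignores the solutions of a single component system in which two of the `d` points are
equal. -/
def IgnoresRepeats {n m k D : ℕ} (d : ℕ) (f : Fin k → MvPolynomial (Fin n ⊕ Fin m) ℂ)
    (Δ : (a : ℕ) → (Fin a × SliceVar n D → ℂ) → Set (TupleVar n m d a → ℂ)) : Prop :=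
  ∀ (c : Fin 1 × SliceVar n D → ℂ), ∀ z ∈ fiberZeros d f 1 c,
    (∃ i i' : Fin d, i ≠ i' ∧ ∀ t : Fin n, z (Sum.inl (0, i, t)) = z (Sum.inl (0, i', t))) →
      z ∈ Δ 1 c

/-- `π_a(V_A(𝓕_a) \ Δ_a)`. -/
def exceptionalSet {n m k D : ℕ} (d : ℕ) (f : Fin k → MvPolynomial (Fin n ⊕ Fin m) ℂ)
    (A : Set (Fin n ⊕ Fin m → ℂ))
    (Δ : (a : ℕ) → (Fin a × SliceVar n D → ℂ) → Set (TupleVar n m d a → ℂ))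
    (a : ℕ) (c : Fin a × SliceVar n D → ℂ) : Set (Fin m → ℂ) :=
  toParam '' (fiberZerosIn d f A a c \ Δ a c)

/-- The fiber `A_p = {x | (x, p) ∈ A}`. -/
def fiber {n m : ℕ} (A : Set (Fin n ⊕ Fin m → ℂ)) (p : Fin m → ℂ) : Set (Fin n → ℂ) :=
  {x | Sum.elim x p ∈ A}

/-- The set `X` has dimension at least `D`, and its part of dimension at least `D` has at least
`d` points on a generic slice. When `X` has dimension `D`, this says that the `D`-dimensional
part of `X` has at least `d` witness points, i.e. degree at least `d`. -/
def HasWitnessPoints {n : ℕ} (D d : ℕ) (X : Set (Fin n → ℂ)) : Prop :=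
  (D : WithBot ℕ∞) ≤ algDim X ∧
    Generic fun c : SliceVar n D → ℂ => (d : ℕ∞) ≤ (partOfDimGE D X ∩ sliceZeros c).encard

end FiberProd

end

open MvPolynomial

noncomputable section

namespace FiberProd

/-! ### Krull dimension and algebraic independence -/

/-! Write E_a(c) for `exceptionalSet`, and let G (`genericExceptionalSet`) be the set of parameters
p that lie in E_1(c') for generic c'. The point is that a stable dimension can only come from G.
Suppose e_a = e_{a+1} = r. Fix generic constants c for the first a copies and vary the last
constants c'. The sets E_{a+1}(c, c') all lie in E_a(c), which has dimension r, and for generic c'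
they also have dimension r. Hence some r coordinates, the same for generic c', map E_{a+1}(c, c')
onto a set containing generic u. Over generic u the fiber of E_a(c) is finite, and for generic c'
one of its points lies in E_{a+1}(c, c'). As finitely many conditions cover a generic one, a single
point p of the fiber works for generic c'. Such a p lies in G, so E_a(c) ∩ G has dimension r
(`HasGenericProjection.generic_mem`, `generic_hasGenericProjection_inter`). Conversely, a point of
E_a(c) ∩ G stays exceptional when a copy with generic constants is appended
(`generic_mem_exceptionalSet_joinConst`). So E_j ∩ G keeps dimension at least r for all j ≥ a, and
e_j = r. The same argument restricted to the complement of G shows that E_{a+1} \ G has dimension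
less than r: otherwise there would be a point both in G and outside it. For p in G, a generic slice
of A_p has d distinct points, and it misses all components of dimension less than D. The technical
basis is that "generic" acts on constructible sets like an ultrafilter with a Fubini rule
(`generic_or`, `generic_comm`), that projections of constructible sets are constructible
(Chevalley), and that dimension at least r means that some projection to r coordinates contains
generic points (`natCast_le_algDim_iff`). -/

theorem ringKrullDim_eq_of_isIntegral {R S : Type*} [CommRing R] [CommRing S] [Algebra R S]
    [Algebra.IsIntegral R S] (h : Function.Injective (algebraMap R S)) :
    ringKrullDim S = ringKrullDim R := by
  have hsurj : Function.Surjective (PrimeSpectrum.comap (algebraMap R S)) :=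
    (Algebra.IsIntegral.isIntegral (R := R) (A := S) |> fun hi =>
      RingHom.IsIntegral.comap_surjective (f := algebraMap R S) hi h)
  -- Incomparability bounds the dimension of `S` above; lying over together with going up lifts
  -- every chain of primes of `R`.
  apply le_antisymm
  · exact Order.krullDim_le_of_strictMono (PrimeSpectrum.comap (algebraMap R S))
      fun I J hIJ => Ideal.IsIntegral.comap_lt_comap (R := R) hIJ
  · refine iSup_le fun l => ?_
    obtain ⟨P, hP⟩ := hsurj l.head
    have : P.asIdeal.LiesOver l.head.asIdeal := ⟨by rw [← hP]; rfl⟩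
    obtain ⟨L, hL, -⟩ := Ideal.exists_ltSeries_of_hasGoingUp l P.asIdeal
    rw [← hL]
    exact le_iSup (fun L : LTSeries (PrimeSpectrum S) => ((L.length : ℕ∞) : WithBot ℕ∞)) L

/-- By Noether normalization `B` is integral over a polynomial ring in `s` variables, which has the
same Krull dimension and the same transcendence degree. -/
theorem exists_ringKrullDim_eq_and_trdeg_eq (K B : Type*) [Field K] [CommRing B] [IsDomain B]
    [Algebra K B] [Algebra.FiniteType K B] :
    ∃ s : ℕ, ringKrullDim B = s ∧ Algebra.trdeg K B = s := by
  obtain ⟨s, g, hg, hint⟩ := exists_integral_inj_algHom_of_fg K B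
  refine ⟨s, ?_, ?_⟩
  · let _ := g.toRingHom.toAlgebra
    have : Algebra.IsIntegral (MvPolynomial (Fin s) K) B := ⟨hint⟩
    rw [ringKrullDim_eq_of_isIntegral (R := MvPolynomial (Fin s) K) (S := B) hg]
    simp
  · let _ := g.toRingHom.toAlgebra
    have : IsScalarTower K (MvPolynomial (Fin s) K) B :=
      IsScalarTower.of_algebraMap_eq fun x => (g.commutes x).symm
    have : Algebra.IsIntegral (MvPolynomial (Fin s) K) B := ⟨hint⟩
    have : FaithfulSMul (MvPolynomial (Fin s) K) B :=
      (faithfulSMul_iff_algebraMap_injective _ _).2 hg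
    have h1 := lift_trdeg_add_eq K (MvPolynomial (Fin s) K) B
    rw [trdeg_eq_zero (R := MvPolynomial (Fin s) K) (A := B)] at h1
    rw [MvPolynomial.trdeg_of_isDomain] at h1
    simp at h1
    exact h1.symm

/-- `B` need not be a domain. The zero ideal of the embedded polynomial ring is the contraction of
some prime `P` of `B`, so independence survives modulo `P`, where transcendence degree and dimension
agree. -/
theorem natCast_le_ringKrullDim_of_algebraicIndependent {K B : Type*} [Field K] [CommRing B]
    [Algebra K B] [Algebra.FiniteType K B] {r : ℕ} {x : Fin r → B}
    (hx : AlgebraicIndependent K x) : (r : WithBot ℕ∞) ≤ ringKrullDim B := by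
  obtain ⟨P, hP, hcomap⟩ := Ideal.exists_comap_eq_of_mem_minimalPrimes_of_injective
    (f := (aeval x : MvPolynomial (Fin r) K →ₐ[K] B).toRingHom) hx ⊥
    (by rw [IsDomain.minimalPrimes_eq_singleton_bot]; rfl)
  have hx' : AlgebraicIndependent K (fun i => Ideal.Quotient.mkₐ K P (x i)) := by
    rw [algebraicIndependent_iff]
    intro p hp
    have h1 : aeval x p ∈ P := by
      rw [← Ideal.Quotient.eq_zero_iff_mem, ← hp]
      exact (MvPolynomial.comp_aeval_apply x (Ideal.Quotient.mkₐ K P) p).trans rfl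
    have h2 : p ∈ P.comap (aeval x : MvPolynomial (Fin r) K →ₐ[K] B).toRingHom := h1
    rw [hcomap] at h2
    simpa using h2
  obtain ⟨s, hs, hs'⟩ := exists_ringKrullDim_eq_and_trdeg_eq K (B ⧸ P)
  have h := hx'.lift_cardinalMk_le_trdeg
  rw [hs'] at h
  simp at h
  calc (r : WithBot ℕ∞) ≤ s := by exact_mod_cast h
    _ = ringKrullDim (B ⧸ P) := hs.symm
    _ ≤ ringKrullDim B := ringKrullDim_quotient_le P

/-- Dividing by the first prime of a chain of length `r` gives a domain of transcendence degree at
least `r`. The images of the generators contain a transcendence basis, and independence lifts back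
from the quotient. -/
theorem exists_algebraicIndependent_of_natCast_le_ringKrullDim {K B : Type*} [Field K]
    [CommRing B] [Algebra K B] {ι : Type*} [Finite ι] {x : ι → B}
    (hx : Algebra.adjoin K (Set.range x) = ⊤) {r : ℕ} (hr : (r : WithBot ℕ∞) ≤ ringKrullDim B) :
    ∃ J : Finset ι, J.card = r ∧ AlgebraicIndependent K fun j : J => x j := by
  classical
  obtain ⟨l, hl⟩ := Order.le_krullDim_iff.1 hr
  set P : Ideal B := l.head.asIdeal with hPdef
  have hdim : (r : WithBot ℕ∞) ≤ ringKrullDim (B ⧸ P) := by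
    rw [ringKrullDim_quotient]
    refine Order.le_krullDim_iff.2 ⟨⟨l.length, fun i => ⟨l i, ?_⟩, fun i => l.step i⟩, hl⟩
    exact l.head_le i
  have hfin : Algebra.FiniteType K B :=
    ⟨⟨(Set.finite_range x).toFinset, by simpa using hx⟩⟩
  set y : ι → B ⧸ P := fun i => Ideal.Quotient.mkₐ K P (x i) with hy
  have hadj : Algebra.adjoin K (Set.range y) = ⊤ := by
    have : Set.range y = Ideal.Quotient.mkₐ K P '' Set.range x := by
      rw [← Set.range_comp]; rfl
    rw [this, ← AlgHom.map_adjoin, hx, Algebra.map_top,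
      AlgHom.range_eq_top]
    exact Ideal.Quotient.mkₐ_surjective K P
  have halg : Algebra.IsAlgebraic (Algebra.adjoin K (Set.range y)) (B ⧸ P) := by
    refine ⟨fun b => ?_⟩
    exact isAlgebraic_algebraMap (⟨b, by rw [hadj]; trivial⟩ : Algebra.adjoin K (Set.range y))
  obtain ⟨s, hs, hs'⟩ := exists_ringKrullDim_eq_and_trdeg_eq K (B ⧸ P)
  obtain ⟨t, ht, hbasis⟩ := exists_isTranscendenceBasis_subset (R := K) (Set.range y)
  have hcard := hbasis.cardinalMk_eq_trdeg
  rw [hs'] at hcard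
  rw [hs] at hdim
  have hrs : r ≤ s := by exact_mod_cast hdim
  have htfin : t.Finite := (Set.finite_range y).subset ht
  have : Fintype t := htfin.fintype
  have hcard' : htfin.toFinset.card = s := by
    have : Fintype.card t = s := by simpa using hcard
    rw [← this, ← Set.toFinset_card]
    congr 1; ext; simp
  obtain ⟨t', ht', hcard''⟩ := Finset.exists_subset_card_eq (hcard'.symm ▸ hrs)
  have hex : ∀ b : t', ∃ i, y i = b := fun b => ht (by simpa using ht' b.2)
  choose g hg using hex
  have hginj : Function.Injective g := fun a b hab => Subtype.ext (by rw [← hg a, ← hg b, hab])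
  refine ⟨Finset.univ.image g, by simp [Finset.card_image_of_injective _ hginj, hcard''], ?_⟩
  apply AlgebraicIndependent.of_comp (Ideal.Quotient.mkₐ K P)
  let φ : ↥(Finset.univ.image g) → t := fun j => ⟨y j, by
    obtain ⟨b, -, hbj⟩ := Finset.mem_image.1 j.2
    rw [← hbj, hg b]
    simpa using ht' b.2⟩
  have hφ : Function.Injective φ := by
    rintro ⟨i, hi⟩ ⟨j, hj⟩ hij
    obtain ⟨b, hb, rfl⟩ := Finset.mem_image.1 hi
    obtain ⟨c, hc, rfl⟩ := Finset.mem_image.1 hj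
    have : y (g b) = y (g c) := congrArg Subtype.val hij
    rw [hg b, hg c] at this
    simp [Subtype.ext this]
  exact hbasis.1.comp φ hφ

/-! ### Generic points -/

theorem generic_iff {σ : Type*} {P : (σ → ℂ) → Prop} :
    Generic P ↔ ∃ g : MvPolynomial σ ℂ, g ≠ 0 ∧ ∀ z, eval z g ≠ 0 → P z := by
  constructor
  · rintro ⟨E, ⟨I, rfl⟩, hne, h⟩
    obtain ⟨z, hz⟩ := (Set.ne_univ_iff_exists_notMem _).1 hne
    simp only [mem_zeroLocus_iff, not_forall] at hz
    obtain ⟨p, hp, hpz⟩ := hz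
    refine ⟨p, fun h0 => hpz (by simp [h0]), fun z hz => h z fun hzE => hz ?_⟩
    simpa [aeval_eq_eval] using hzE p hp
  · rintro ⟨g, hg, h⟩
    refine ⟨_, ⟨Ideal.span {g}, rfl⟩, fun hE => hg (MvPolynomial.funext fun z => ?_), fun z hz =>
      h z fun h0 => hz ?_⟩
    · have : z ∈ zeroLocus ℂ (Ideal.span {g}) := hE ▸ Set.mem_univ z
      rw [zeroLocus_span] at this
      simpa [aeval_eq_eval] using this
    · rw [zeroLocus_span]
      simpa [aeval_eq_eval] using h0

theorem generic_eval_ne_zero {σ : Type*} {g : MvPolynomial σ ℂ} (hg : g ≠ 0) :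
    Generic fun z => eval z g ≠ 0 :=
  generic_iff.2 ⟨g, hg, fun _ h => h⟩

namespace Generic

variable {σ τ : Type*} {P Q : (σ → ℂ) → Prop}

theorem mono (h : Generic P) (hPQ : ∀ z, P z → Q z) : Generic Q := by
  obtain ⟨E, hE, hne, hP⟩ := h
  exact ⟨E, hE, hne, fun z hz => hPQ z (hP z hz)⟩

theorem of_forall (h : ∀ z, P z) : Generic P :=
  generic_iff.2 ⟨1, one_ne_zero, fun z _ => h z⟩

theorem and (hP : Generic P) (hQ : Generic Q) : Generic fun z => P z ∧ Q z := by
  obtain ⟨f, hf, hP⟩ := generic_iff.1 hP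
  obtain ⟨g, hg, hQ⟩ := generic_iff.1 hQ
  refine generic_iff.2 ⟨f * g, mul_ne_zero hf hg, fun z hz => ?_⟩
  rw [map_mul] at hz
  exact ⟨hP z (left_ne_zero_of_mul hz), hQ z (right_ne_zero_of_mul hz)⟩

theorem exists_point (h : Generic P) : ∃ z, P z := by
  obtain ⟨E, -, hne, hP⟩ := h
  obtain ⟨z, hz⟩ := (Set.ne_univ_iff_exists_notMem _).1 hne
  exact ⟨z, hP z hz⟩

theorem not_not (h : Generic P) : ¬ Generic fun z => ¬ P z := fun h' => by
  obtain ⟨z, h1, h2⟩ := (h.and h').exists_point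
  exact h2 h1

theorem forall_finite {ι : Type*} [Finite ι] {P : ι → (σ → ℂ) → Prop}
    (h : ∀ i, Generic (P i)) : Generic fun z => ∀ i, P i z := by
  have := Fintype.ofFinite ι
  choose g hg hP using fun i => generic_iff.1 (h i)
  refine generic_iff.2 ⟨∏ i, g i, Finset.prod_ne_zero_iff.2 fun i _ => hg i, fun z hz i => ?_⟩
  rw [map_prod] at hz
  exact hP i z (Finset.prod_ne_zero_iff.1 hz i (Finset.mem_univ i))

theorem comp_injective (h : Generic P) {φ : σ → τ} (hφ : Function.Injective φ) :
    Generic fun w : τ → ℂ => P fun i => w (φ i) := by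
  obtain ⟨g, hg, hP⟩ := generic_iff.1 h
  refine generic_iff.2 ⟨rename φ g, fun h0 => hg (rename_injective φ hφ (by simpa using h0)),
    fun w hw => hP _ ?_⟩
  rwa [eval_rename] at hw

theorem comp_equiv_iff (e : σ ≃ τ) :
    (Generic fun w : τ → ℂ => P fun i => w (e i)) ↔ Generic P := by
  refine ⟨fun h => ?_, fun h => h.comp_injective e.injective⟩
  simpa using h.comp_injective e.symm.injective

end Generic

theorem generic_eval_eq_zero_iff {σ : Type*} {g : MvPolynomial σ ℂ} :
    (Generic fun z => eval z g = 0) ↔ g = 0 := by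
  refine ⟨fun h => by_contra fun hg => h.not_not (generic_eval_ne_zero hg), ?_⟩
  rintro rfl
  exact .of_forall fun z => by simp

/-! ### Constructible sets -/

/-- The constructible subsets of an affine space: the Boolean combinations of hypersurfaces. -/
inductive IsConstructibleSet {σ : Type*} : Set (σ → ℂ) → Prop
  | zeros (f : MvPolynomial σ ℂ) : IsConstructibleSet {x | eval x f = 0}
  | compl {S : Set (σ → ℂ)} : IsConstructibleSet S → IsConstructibleSet Sᶜ
  | inter {S T : Set (σ → ℂ)} : IsConstructibleSet S → IsConstructibleSet T →
      IsConstructibleSet (S ∩ T)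

namespace IsConstructibleSet

variable {σ τ : Type*} {S T : Set (σ → ℂ)} {P Q : (σ → ℂ) → Prop}

theorem not (h : IsConstructibleSet {x | P x}) : IsConstructibleSet {x | ¬ P x} := h.compl

theorem and (h : IsConstructibleSet {x | P x}) (h' : IsConstructibleSet {x | Q x}) :
    IsConstructibleSet {x | P x ∧ Q x} := h.inter h'

theorem const (p : Prop) : IsConstructibleSet {_x : σ → ℂ | p} := by
  by_cases hp : p
  · simpa [hp] using zeros (0 : MvPolynomial σ ℂ)
  · simpa [hp] using zeros (1 : MvPolynomial σ ℂ)

theorem forall_finite {ι : Type*} [Finite ι] {P : ι → (σ → ℂ) → Prop}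
    (h : ∀ i, IsConstructibleSet {x | P i x}) : IsConstructibleSet {x | ∀ i, P i x} := by
  induction ι using Finite.induction_empty_option with
  | of_equiv e ih => simpa [e.forall_congr_left] using ih fun i => h (e i)
  | h_empty => simpa using const True
  | h_option ih => simpa [Option.forall] using (h none).and (ih fun i => h (some i))

theorem exists_finite {ι : Type*} [Finite ι] {P : ι → (σ → ℂ) → Prop}
    (h : ∀ i, IsConstructibleSet {x | P i x}) : IsConstructibleSet {x | ∃ i, P i x} := by
  simpa using (forall_finite fun i => (h i).not).not

theorem preimage (h : IsConstructibleSet S) (φ : σ → MvPolynomial τ ℂ) :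
    IsConstructibleSet {w : τ → ℂ | (fun i => eval w (φ i)) ∈ S} := by
  induction h with
  | zeros f =>
    convert zeros (bind₁ φ f) using 3 with w
    simp only [Set.mem_ofPred_eq]
    rw [← aeval_eq_eval, ← aeval_eq_eval, aeval_bind₁]
  | compl _ ih => exact ih.compl
  | inter _ _ ih ih' => exact ih.inter ih'

theorem comp (h : IsConstructibleSet S) (φ : σ → τ) :
    IsConstructibleSet {w : τ → ℂ | (fun i => w (φ i)) ∈ S} := by
  simpa using h.preimage fun i => X (φ i)

theorem _root_.FiberProd.IsAlgebraicSet.isConstructibleSet [Finite σ] (h : IsAlgebraicSet S) :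
    IsConstructibleSet S := by
  obtain ⟨I, rfl⟩ := h
  obtain ⟨s, rfl⟩ := (isNoetherianRing_iff_ideal_fg _).1 inferInstance I
  convert forall_finite (P := fun (f : s) x => eval x (f : MvPolynomial σ ℂ) = 0)
    fun f => zeros (f : MvPolynomial σ ℂ)
  rw [zeroLocus_span]
  ext x
  simp [aeval_eq_eval]

/-- A hypersurface is either the whole space or a proper closed set, and the dichotomy passes to
Boolean combinations. Hence "generic" commutes with negation and with finite disjunctions of
constructible conditions. -/
theorem generic_or (h : IsConstructibleSet S) :
    (Generic fun x => x ∈ S) ∨ Generic fun x => x ∉ S := by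
  induction h with
  | zeros f =>
    by_cases hf : f = 0
    · exact .inl (generic_eval_eq_zero_iff.2 hf)
    · exact .inr (generic_eval_ne_zero hf)
  | compl _ ih => simpa using ih.symm
  | inter _ _ ih ih' =>
    rcases ih with ih | ih
    · rcases ih' with ih' | ih'
      · exact .inl (ih.and ih')
      · exact .inr (ih'.mono fun z hz hz' => hz hz'.2)
    · exact .inr (ih.mono fun z hz hz' => hz hz'.1)

theorem generic_not_iff (h : IsConstructibleSet {x | P x}) :
    (Generic fun x => ¬ P x) ↔ ¬ Generic P :=
  ⟨fun h1 h2 => h2.not_not h1, fun h1 => h.generic_or.resolve_left h1⟩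

theorem generic_exists_finite {ι : Type*} [Finite ι] {P : ι → (σ → ℂ) → Prop}
    (h : ∀ i, IsConstructibleSet {x | P i x}) :
    (Generic fun x => ∃ i, P i x) ↔ ∃ i, Generic (P i) := by
  refine ⟨fun hG => by_contra fun hne => ?_, fun ⟨i, hi⟩ => hi.mono fun x hx => ⟨i, hx⟩⟩
  push Not at hne
  have := Generic.forall_finite fun i => (h i).generic_not_iff.2 (hne i)
  exact hG.not_not (this.mono fun x hx ⟨i, hi⟩ => hx i hi)

end IsConstructibleSet

theorem generic_and_iff {σ : Type*} {P Q : (σ → ℂ) → Prop} :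
    (Generic fun x => P x ∧ Q x) ↔ Generic P ∧ Generic Q :=
  ⟨fun h => ⟨h.mono fun _ h => h.1, h.mono fun _ h => h.2⟩, fun h => h.1.and h.2⟩

/-! ### Quantifiers over constructible sets -/

section Quantifiers

variable {σ τ : Type*}

/-- A polynomial in two groups of variables as a polynomial in the second group whose coefficients
are polynomials in the first group. -/
def curryPolynomial : MvPolynomial (σ ⊕ τ) ℂ ≃ₐ[ℂ] MvPolynomial τ (MvPolynomial σ ℂ) :=
  (renameEquiv ℂ (Equiv.sumComm σ τ)).trans (sumAlgEquiv ℂ τ σ)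

theorem eval_map_curryPolynomial (f : MvPolynomial (σ ⊕ τ) ℂ) (w : σ ⊕ τ → ℂ) :
    eval (fun j => w (Sum.inr j)) (map (eval fun i => w (Sum.inl i)) (curryPolynomial f)) =
      eval w f := by
  have : ((eval fun j => w (Sum.inr j)).comp ((map (eval fun i => w (Sum.inl i))).comp
      (curryPolynomial (σ := σ) (τ := τ) : _ →+* _))) = eval w := by
    refine MvPolynomial.ringHom_ext (fun r => ?_) fun v => ?_
    · simp [curryPolynomial]
    · rcases v with i | j <;> simp [curryPolynomial]
  exact RingHom.congr_fun this f

theorem generic_eval_sum_iff {f : MvPolynomial (σ ⊕ τ) ℂ} {x : σ → ℂ} :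
    (Generic fun y : τ → ℂ => eval (Sum.elim x y) f = 0) ↔
      ∀ m : (curryPolynomial f).support, eval x ((curryPolynomial f).coeff m) = 0 := by
  have h : ∀ y : τ → ℂ, eval (Sum.elim x y) f = eval y (map (eval x) (curryPolynomial f)) :=
    fun y => (eval_map_curryPolynomial f (Sum.elim x y)).symm
  simp only [h, generic_eval_eq_zero_iff]
  rw [MvPolynomial.ext_iff]
  simp only [coeff_map, coeff_zero, Subtype.forall]
  refine ⟨fun h m _ => h m, fun h m => ?_⟩
  by_cases hm : m ∈ (curryPolynomial f).support
  · exact h m hm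
  · simp [notMem_support_iff.1 hm]

theorem IsConstructibleSet.fiber_right_mem {T : Set (σ ⊕ τ → ℂ)} (h : IsConstructibleSet T)
    (x : σ → ℂ) : IsConstructibleSet {y : τ → ℂ | Sum.elim x y ∈ T} := by
  convert h.preimage (Sum.elim (fun i => C (x i)) X) using 3 with y
  congr! 1
  ext (i | j) <;> simp

/-- For a hypersurface, `f (x, ·)` vanishes identically exactly when its finitely many coefficients,
which are polynomials in `x`, vanish. -/
theorem IsConstructibleSet.generic_right_mem {T : Set (σ ⊕ τ → ℂ)} (h : IsConstructibleSet T) :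
    IsConstructibleSet {x : σ → ℂ | Generic fun y : τ → ℂ => Sum.elim x y ∈ T} := by
  induction h with
  | zeros f =>
    simp only [Set.mem_ofPred_eq, generic_eval_sum_iff]
    exact .forall_finite fun m => .zeros _
  | compl h ih =>
    convert ih.compl with x
    ext x
    exact (h.fiber_right_mem x).generic_not_iff
  | inter _ _ ih ih' =>
    simp only [Set.mem_inter_iff, generic_and_iff]
    exact ih.and ih'

theorem IsConstructibleSet.generic_right {P : (σ → ℂ) → (τ → ℂ) → Prop}
    (h : IsConstructibleSet {w : σ ⊕ τ → ℂ | P (w ∘ Sum.inl) (w ∘ Sum.inr)}) :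
    IsConstructibleSet {x | Generic (P x)} :=
  h.generic_right_mem

/-- A Fubini rule: a nonzero `f` has a nonzero coefficient as a polynomial in the second variables,
and `f (x, ·)` is nonzero wherever that coefficient is. -/
theorem IsConstructibleSet.generic_mem_iff {T : Set (σ ⊕ τ → ℂ)} (h : IsConstructibleSet T) :
    (Generic fun w => w ∈ T) ↔
      Generic fun x : σ → ℂ => Generic fun y : τ → ℂ => Sum.elim x y ∈ T := by
  induction h with
  | zeros f =>
    simp only [Set.mem_ofPred_eq, generic_eval_sum_iff]
    rw [generic_eval_eq_zero_iff]
    constructor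
    · rintro rfl
      exact .of_forall fun x m => by simp
    · intro hG
      by_contra hf
      have hF : curryPolynomial f ≠ 0 := by simpa using hf
      obtain ⟨m, hm⟩ := support_nonempty.2 hF
      exact (hG.mono fun x hx => hx ⟨m, hm⟩).not_not (generic_eval_ne_zero (mem_support_iff.1 hm))
  | compl h ih =>
    have h1 := h.generic_not_iff
    have h2 := h.generic_right_mem.generic_not_iff
    refine h1.trans ((not_congr ih).trans (h2.symm.trans ?_))
    simp only [Set.mem_compl_iff, fun x => (h.fiber_right_mem x).generic_not_iff]
  | inter _ _ ih ih' =>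
    simp only [Set.mem_inter_iff, generic_and_iff, ih, ih']

theorem IsConstructibleSet.generic_sum_iff {P : (σ → ℂ) → (τ → ℂ) → Prop}
    (h : IsConstructibleSet {w : σ ⊕ τ → ℂ | P (w ∘ Sum.inl) (w ∘ Sum.inr)}) :
    (Generic fun w : σ ⊕ τ → ℂ => P (w ∘ Sum.inl) (w ∘ Sum.inr)) ↔
      Generic fun x => Generic (P x) :=
  h.generic_mem_iff

theorem IsConstructibleSet.generic_comm {P : (σ → ℂ) → (τ → ℂ) → Prop}
    (h : IsConstructibleSet {w : σ ⊕ τ → ℂ | P (w ∘ Sum.inl) (w ∘ Sum.inr)}) :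
    (Generic fun x => Generic fun y => P x y) ↔ Generic fun y => Generic fun x => P x y := by
  have h' : IsConstructibleSet {w : τ ⊕ σ → ℂ | P (w ∘ Sum.inr) (w ∘ Sum.inl)} :=
    h.comp (Equiv.sumComm σ τ)
  exact h.generic_sum_iff.symm.trans
    ((Generic.comp_equiv_iff (Equiv.sumComm σ τ)).symm.trans (h'.generic_sum_iff (P := fun y x => P x y)))

theorem IsConstructibleSet.exists_primeSpectrum {S : Set (σ → ℂ)} (h : IsConstructibleSet S) :
    ∃ T : Set (PrimeSpectrum (MvPolynomial σ ℂ)), Topology.IsConstructible T ∧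
      ∀ x, pointToPoint x ∈ T ↔ x ∈ S := by
  induction h with
  | zeros f =>
    refine ⟨(PrimeSpectrum.basicOpen f : Set _)ᶜ, ?_, fun x => ?_⟩
    · rw [Topology.isConstructible_compl]
      exact (PrimeSpectrum.isCompact_basicOpen f).isConstructible (PrimeSpectrum.isOpen_basicOpen)
    · simp [pointToPoint, aeval_eq_eval]
  | compl _ ih =>
    obtain ⟨T, hT, h⟩ := ih
    exact ⟨Tᶜ, Topology.isConstructible_compl.2 hT, fun x => not_congr (h x)⟩
  | inter _ _ ih ih' =>
    obtain ⟨T, hT, h⟩ := ih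
    obtain ⟨T', hT', h'⟩ := ih'
    exact ⟨T ∩ T', hT.inter hT', fun x => and_congr (h x) (h' x)⟩

theorem isConstructibleSet_of_primeSpectrum {T : Set (PrimeSpectrum (MvPolynomial σ ℂ))}
    (hT : Topology.IsConstructible T) : IsConstructibleSet {x | pointToPoint x ∈ T} := by
  obtain ⟨S, rfl⟩ := PrimeSpectrum.exists_constructibleSetData_iff.2 hT
  have hzero (x : σ → ℂ) (f : MvPolynomial σ ℂ) :
      f ∈ (pointToPoint (k := ℂ) x).asIdeal ↔ eval x f = 0 :=
    mem_vanishingIdeal_singleton_iff x f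
  have hS : {x : σ → ℂ | pointToPoint x ∈ S.toSet} =
      {x | ∃ C : S, (∀ i, eval x (C.1.g i) = 0) ∧ ¬ eval x C.1.f = 0} := by
    ext x
    simp only [PrimeSpectrum.ConstructibleSetData.toSet, Set.mem_iUnion, Subtype.exists,
      exists_prop, PrimeSpectrum.BasicConstructibleSetData.toSet, Set.mem_sdiff, Set.mem_ofPred_eq,
      PrimeSpectrum.mem_zeroLocus, Set.range_subset_iff, Set.singleton_subset_iff,
      SetLike.mem_coe, hzero]
  rw [hS]
  refine .exists_finite fun C => .and (.forall_finite fun i => .zeros _) (.not (.zeros _))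

/-- By the Nullstellensatz, a polynomial outside the prime `q` is nonzero at some closed point of
V(`q`). This brings Chevalley's theorem from the prime spectrum down to complex points. -/
theorem exists_point_of_mem_isConstructible [Finite σ]
    {T : Set (PrimeSpectrum (MvPolynomial σ ℂ))} (hT : Topology.IsConstructible T)
    {q : PrimeSpectrum (MvPolynomial σ ℂ)} (hq : q ∈ T) :
    ∃ x : σ → ℂ, pointToPoint x ∈ T ∧ ∀ p ∈ q.asIdeal, eval x p = 0 := by
  obtain ⟨S, rfl⟩ := PrimeSpectrum.exists_constructibleSetData_iff.2 hT
  simp only [PrimeSpectrum.ConstructibleSetData.toSet, Set.mem_iUnion] at hq ⊢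
  obtain ⟨C, hC, hg, hf⟩ := hq
  simp only [PrimeSpectrum.mem_zeroLocus, Set.singleton_subset_iff, SetLike.mem_coe] at hf hg
  have := q.2
  rw [← IsPrime.vanishingIdeal_zeroLocus (K := ℂ) q.asIdeal, mem_vanishingIdeal_iff] at hf
  push Not at hf
  obtain ⟨x, hx, hfx⟩ := hf
  refine ⟨x, ⟨C, hC, fun p hp => ?_, fun h => hfx ?_⟩, hx⟩
  · exact (mem_vanishingIdeal_singleton_iff x p).2 (hx p (hg hp))
  · exact (mem_vanishingIdeal_singleton_iff x _).1 (h rfl)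

theorem IsConstructibleSet.exists_right [Finite σ] [Finite τ] {P : (σ → ℂ) → (τ → ℂ) → Prop}
    (h : IsConstructibleSet {w : σ ⊕ τ → ℂ | P (w ∘ Sum.inl) (w ∘ Sum.inr)}) :
    IsConstructibleSet {x | ∃ y, P x y} := by
  obtain ⟨T, hT, hTP⟩ := h.exists_primeSpectrum
  let φ : MvPolynomial σ ℂ →+* MvPolynomial (σ ⊕ τ) ℂ := (rename Sum.inl).toRingHom
  have hφ : φ.FinitePresentation := by
    rw [← RingHom.FinitePresentation.of_finiteType]
    refine RingHom.FiniteType.of_comp_finiteType (f := C) ?_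
    have : φ.comp C = C := by ext; simp [φ]
    rw [this]
    exact RingHom.finiteType_algebraMap.2 inferInstance
  convert isConstructibleSet_of_primeSpectrum (PrimeSpectrum.isConstructible_comap_image hφ hT)
    with x
  constructor
  · rintro ⟨y, hy⟩
    refine ⟨pointToPoint (Sum.elim x y), (hTP _).2 hy, ?_⟩
    ext p
    simp [φ, pointToPoint, aeval_eq_eval, eval_rename]
  · rintro ⟨q, hq, hqx⟩
    obtain ⟨w, hw, hwq⟩ := exists_point_of_mem_isConstructible hT hq
    refine ⟨w ∘ Sum.inr, ?_⟩
    have hx : w ∘ Sum.inl = x := by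
      ext i
      -- The image of `q` is the maximal ideal of `x`, so every zero `w` of `q` has first block of
      -- coordinates `x`.
      have h1 : X i - C (x i) ∈ (PrimeSpectrum.comap φ q).asIdeal := by
        rw [hqx]
        simp [pointToPoint]
      have h2 := hwq _ h1
      simpa [φ, sub_eq_zero] using h2
    rw [← hx]
    exact (hTP w).1 hw

end Quantifiers

/-! ### Dimension and generic projections -/

section Dimension

variable {σ τ : Type*}

theorem vanishingIdeal_zariskiClosure (S : Set (σ → ℂ)) :
    vanishingIdeal ℂ (zariskiClosure S) = vanishingIdeal ℂ S :=
  le_antisymm (vanishingIdeal_anti_mono (zeroLocus_vanishingIdeal_le S))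
    (le_vanishingIdeal_zeroLocus _)

theorem algDim_zariskiClosure (S : Set (σ → ℂ)) : algDim (zariskiClosure S) = algDim S := by
  rw [algDim, vanishingIdeal_zariskiClosure, algDim]

theorem algDim_mono {S T : Set (σ → ℂ)} (h : S ⊆ T) : algDim S ≤ algDim T :=
  ringKrullDim_le_of_surjective
    (Ideal.Quotient.factor (vanishingIdeal_anti_mono (k := ℂ) h)) (Ideal.Quotient.factor_surjective _)

/-- A polynomial relation between the `φ i` on `S` would vanish at generic `u`, hence be zero. -/
theorem natCast_le_algDim_of_generic [Finite σ] {r : ℕ} {S : Set (σ → ℂ)}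
    (φ : Fin r → MvPolynomial σ ℂ)
    (h : Generic fun u : Fin r → ℂ => ∃ x ∈ S, ∀ i, eval x (φ i) = u i) :
    (r : WithBot ℕ∞) ≤ algDim S := by
  refine natCast_le_ringKrullDim_of_algebraicIndependent (K := ℂ)
    (x := fun i => Ideal.Quotient.mkₐ ℂ (vanishingIdeal ℂ S) (φ i)) ?_
  rw [algebraicIndependent_iff]
  intro p hp
  have hmem : aeval φ p ∈ vanishingIdeal ℂ S := by
    rw [← Ideal.Quotient.eq_zero_iff_mem, ← hp]
    exact comp_aeval_apply φ (Ideal.Quotient.mkₐ ℂ (vanishingIdeal ℂ S)) p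
  refine generic_eval_eq_zero_iff.1 (h.mono ?_)
  rintro u ⟨x, hx, hxu⟩
  have := hmem x hx
  rw [comp_aeval_apply, aeval_eq_eval] at this
  convert! this using 3
  exact funext fun i => (hxu i).symm

/-- The projection of `S` to some `r` of the coordinates contains all generic points. -/
def HasGenericProjection (r : ℕ) (S : Set (σ → ℂ)) : Prop :=
  ∃ J : {J : Finset σ // J.card = r},
    Generic fun u : J.1 → ℂ => ∃ x, x ∈ S ∧ ∀ j : J.1, x j = u j

theorem HasGenericProjection.mono {r : ℕ} {S T : Set (σ → ℂ)} (h : HasGenericProjection r S)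
    (hST : S ⊆ T) : HasGenericProjection r T :=
  h.imp fun _ hJ => hJ.mono fun _ ⟨x, hx, hxu⟩ => ⟨x, hST hx, hxu⟩

theorem HasGenericProjection.nonempty {r : ℕ} {S : Set (σ → ℂ)} (h : HasGenericProjection r S) :
    S.Nonempty := by
  obtain ⟨J, hJ⟩ := h
  obtain ⟨u, x, hx, -⟩ := hJ.exists_point
  exact ⟨x, hx⟩

theorem IsConstructibleSet.projection {P : (σ → ℂ) → (τ → ℂ) → Prop} [Finite σ] [Finite τ]
    (h : IsConstructibleSet {w : σ ⊕ τ → ℂ | P (w ∘ Sum.inl) (w ∘ Sum.inr)}) (J : Finset τ) :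
    IsConstructibleSet {w : σ ⊕ J → ℂ | ∃ x, P (w ∘ Sum.inl) x ∧ ∀ j : J, x j = w (Sum.inr j)} := by
  refine IsConstructibleSet.exists_right
    (P := fun (w : σ ⊕ J → ℂ) x => P (w ∘ Sum.inl) x ∧ ∀ j : J, x j = w (Sum.inr j)) (.and ?_ ?_)
  · exact h.comp (Sum.elim (Sum.inl ∘ Sum.inl) Sum.inr)
  · refine .forall_finite fun j => ?_
    convert IsConstructibleSet.zeros (X (Sum.inr j.1) - X (Sum.inl (Sum.inr j)) :
      MvPolynomial ((σ ⊕ J) ⊕ τ) ℂ) using 3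
    simp [sub_eq_zero]

theorem IsConstructibleSet.hasGenericProjection {P : (σ → ℂ) → (τ → ℂ) → Prop} [Finite σ]
    [Finite τ] (h : IsConstructibleSet {w : σ ⊕ τ → ℂ | P (w ∘ Sum.inl) (w ∘ Sum.inr)}) (r : ℕ) :
    IsConstructibleSet {c | HasGenericProjection r {x | P c x}} :=
  .exists_finite fun J => .generic_right
    (P := fun c (u : J.1 → ℂ) => ∃ x, P c x ∧ ∀ j : J.1, x j = u j) (h.projection J.1)

theorem IsConstructibleSet.projection_right {S : Set (τ → ℂ)} [Finite τ]
    (h : IsConstructibleSet S) (J : Finset τ) :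
    IsConstructibleSet {u : J → ℂ | ∃ x, x ∈ S ∧ ∀ j : J, x j = u j} :=
  ((IsConstructibleSet.projection (σ := Empty) (P := fun _ x => x ∈ S)
    (h.comp Sum.inr) J).fiber_right_mem Empty.elim :)

theorem natCast_le_algDim_iff [Finite σ] {r : ℕ} {S : Set (σ → ℂ)} (hS : IsConstructibleSet S) :
    (r : WithBot ℕ∞) ≤ algDim S ↔ HasGenericProjection r S := by
  constructor
  · intro h
    have hadj : Algebra.adjoin ℂ (Set.range fun i : σ =>
        Ideal.Quotient.mkₐ ℂ (vanishingIdeal ℂ S) (X i)) = ⊤ := by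
      have : (Set.range fun i : σ => Ideal.Quotient.mkₐ ℂ (vanishingIdeal ℂ S) (X i)) =
          Ideal.Quotient.mkₐ ℂ (vanishingIdeal ℂ S) '' Set.range X := by
        rw [← Set.range_comp]; rfl
      rw [this, ← AlgHom.map_adjoin, adjoin_range_X, Algebra.map_top, AlgHom.range_eq_top]
      exact Ideal.Quotient.mkₐ_surjective ℂ _
    obtain ⟨J, hJ, hind⟩ := exists_algebraicIndependent_of_natCast_le_ringKrullDim hadj h
    -- If the projection to the independent coordinates `J` misses generic points, some nonzero `g`
    -- vanishes on it, which is a relation between these coordinates on `S`. Constructibility turns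
    -- "not generic" into "generically not".
    refine ⟨⟨J, hJ⟩, by_contra fun hgen => ?_⟩
    obtain ⟨g, hg, hgS⟩ := generic_iff.1 ((hS.projection_right J).generic_not_iff.2 hgen)
    refine hg ((algebraicIndependent_iff.1 hind) g ?_)
    have hmem : rename (Subtype.val : J → σ) g ∈ vanishingIdeal ℂ S := fun x hx => by
      rw [aeval_eq_eval]
      by_contra hne
      exact hgS (fun j => x j) (by simpa [eval_rename, Function.comp_def] using! hne)
        ⟨x, hx, fun _ => rfl⟩
    rw [← Ideal.Quotient.eq_zero_iff_mem] at hmem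
    rw [← hmem, rename_eq_aeval]
    exact (comp_aeval_apply _ (Ideal.Quotient.mkₐ ℂ (vanishingIdeal ℂ S)) g).symm
  · rintro ⟨⟨J, hJ⟩, hgen⟩
    let e : J ≃ Fin r := J.equivFinOfCardEq hJ
    refine natCast_le_algDim_of_generic (fun i => X (e.symm i : σ)) ?_
    refine (hgen.comp_injective e.injective).mono ?_
    rintro u ⟨x, hx, hxu⟩
    exact ⟨x, hx, fun i => by simpa using hxu (e.symm i)⟩

theorem finite_not_of_generic_unit {P : (Unit → ℂ) → Prop} (h : Generic P) :
    {s : ℂ | ¬ P fun _ => s}.Finite := by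
  obtain ⟨g, hg, hP⟩ := generic_iff.1 h
  have hg' : uniqueAlgEquiv ℂ Unit g ≠ 0 :=
    (EmbeddingLike.map_ne_zero_iff (f := uniqueAlgEquiv ℂ Unit)).2 hg
  refine (Polynomial.finite_setOfPred_isRoot hg').subset fun s hs => ?_
  by_contra hne
  refine hs (hP _ fun h0 => hne ?_)
  exact (eval₂_uniqueAlgEquiv (φ := RingHom.id ℂ) (a := fun _ : Unit => s)).trans h0

theorem generic_finite_fiber [Finite σ] {r : ℕ} {S : Set (σ → ℂ)} (hS : IsConstructibleSet S)
    (hr : ¬ HasGenericProjection (r + 1) S) {J : Finset σ} (hJ : J.card = r) :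
    Generic fun u : J → ℂ => {x | x ∈ S ∧ ∀ j : J, x j = u j}.Finite := by
  classical
  have key : ∀ t : σ, Generic fun u : J → ℂ =>
      {s : ℂ | ∃ x, (x ∈ S ∧ ∀ j : J, x j = u j) ∧ x t = s}.Finite := by
    intro t
    by_cases ht : t ∈ J
    · refine .of_forall fun u => (Set.finite_singleton (u ⟨t, ht⟩)).subset ?_
      rintro s ⟨x, ⟨-, hx⟩, rfl⟩
      exact hx ⟨t, ht⟩
    · let e : ↥(insert t J) ≃ J ⊕ Unit := (Finset.subtypeInsertEquivOption ht).trans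
        (Equiv.optionEquivSumPUnit _)
      have hcons : IsConstructibleSet {w : J ⊕ Unit → ℂ |
          ∃ x, x ∈ S ∧ ∀ j : ↥(insert t J), x j = w (e j)} :=
        (hS.projection_right (insert t J)).comp e
      -- The projection to the `r + 1` coordinates `insert t J` is not generic. By Fubini, over
      -- generic `u` the coordinate `t` then takes only values in a proper closed subset of the
      -- line, which is finite.
      have h1 : ¬ Generic fun w : J ⊕ Unit → ℂ =>
          ∃ x, x ∈ S ∧ ∀ j : ↥(insert t J), x j = w (e j) := by
        intro hgen
        refine hr ⟨⟨insert t J, by rw [Finset.card_insert_of_notMem ht, hJ]⟩, ?_⟩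
        simpa using! hgen.comp_injective e.symm.injective
      have h2 := hcons.compl.generic_mem_iff.1 (hcons.generic_not_iff.2 h1)
      refine h2.mono fun u hu => (finite_not_of_generic_unit hu).subset ?_
      rintro s ⟨x, ⟨hx, hxu⟩, rfl⟩
      simp only [Set.mem_compl_iff, Set.mem_ofPred_eq, not_not]
      refine ⟨x, hx, fun ⟨j, hj⟩ => ?_⟩
      by_cases hjt : j = t
      · subst hjt
        simp [e, Finset.subtypeInsertEquivOption]
      · have hjJ : j ∈ J := (Finset.mem_insert.1 hj).resolve_left hjt
        simpa [e, Finset.subtypeInsertEquivOption, hjt] using hxu ⟨j, hjJ⟩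
  refine (Generic.forall_finite key).mono fun u hu => (Set.Finite.pi' hu).subset ?_
  exact fun x hx t => ⟨x, hx, rfl⟩

/-- The core of the argument: subsets of `S` that vary with `c` but keep the full dimension `r` must
share points. Over generic `u` only finitely many points of `S` are available, so one of them
belongs to the subset for generic `c`. -/
theorem HasGenericProjection.generic_mem [Finite σ] [Finite τ] {P : (σ → ℂ) → (τ → ℂ) → Prop}
    (hP : IsConstructibleSet {w : σ ⊕ τ → ℂ | P (w ∘ Sum.inl) (w ∘ Sum.inr)})
    {S : Set (τ → ℂ)} (hS : IsConstructibleSet S) {r : ℕ} (hr : ¬ HasGenericProjection (r + 1) S)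
    (hPS : ∀ c x, P c x → x ∈ S) (h : Generic fun c => HasGenericProjection r {x | P c x}) :
    HasGenericProjection r {x | Generic fun c => P c x} := by
  have hproj (J : Finset τ) := hP.projection J
  -- There are finitely many coordinate sets, so one `J` serves generic `c`.
  obtain ⟨J, hJ⟩ := (IsConstructibleSet.generic_exists_finite
    (P := fun (J : {J : Finset τ // J.card = r}) c => Generic fun u : J.1 → ℂ =>
      ∃ x, P c x ∧ ∀ j : J.1, x j = u j)
    fun J => IsConstructibleSet.generic_right (hproj J.1)).1 h
  refine ⟨J, ?_⟩
  have hswap := (IsConstructibleSet.generic_comm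
    (P := fun c (u : J.1 → ℂ) => ∃ x, P c x ∧ ∀ j : J.1, x j = u j) (hproj J.1)).1 hJ
  refine (hswap.and (generic_finite_fiber hS hr J.2)).mono ?_
  rintro u ⟨hu, hfin⟩
  have := hfin.to_subtype
  have hex : Generic fun c => ∃ x : {x | x ∈ S ∧ ∀ j : J.1, x j = u j}, P c x :=
    hu.mono fun c ⟨x, hx, hxu⟩ => ⟨⟨x, hPS c x hx, hxu⟩, hx⟩
  obtain ⟨x, hx⟩ := (IsConstructibleSet.generic_exists_finite
    (P := fun (x : {x | x ∈ S ∧ ∀ j : J.1, x j = u j}) c => P c x) fun x =>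
    (hP.comp (Equiv.sumComm σ τ)).fiber_right_mem x.1).1 hex
  exact ⟨x, hx, x.2.2⟩

theorem generic_hasGenericProjection [Finite σ] [Finite τ] {P : (σ → ℂ) → (τ → ℂ) → Prop}
    (hP : IsConstructibleSet {w : σ ⊕ τ → ℂ | P (w ∘ Sum.inl) (w ∘ Sum.inr)}) {r : ℕ}
    (h : HasGenericProjection r {x | Generic fun c => P c x}) :
    Generic fun c => HasGenericProjection r {x | P c x} := by
  obtain ⟨J, hJ⟩ := h
  have hswap := (IsConstructibleSet.generic_comm
    (P := fun c (u : J.1 → ℂ) => ∃ x, P c x ∧ ∀ j : J.1, x j = u j) (hP.projection J.1)).2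
    (hJ.mono fun u ⟨x, hx, hxu⟩ => hx.mono fun c hc => ⟨x, hc, hxu⟩)
  exact hswap.mono fun c hc => ⟨J, hc⟩

end Dimension

/-! ### Irreducible components -/

section Components

variable {σ : Type*}

theorem IsAlgebraicSet.zeroLocus_vanishingIdeal {X : Set (σ → ℂ)} (h : IsAlgebraicSet X) :
    zeroLocus ℂ (vanishingIdeal ℂ X) = X := by
  obtain ⟨I, rfl⟩ := h
  exact Set.Subset.antisymm (zeroLocus_anti_mono (le_vanishingIdeal_zeroLocus I))
    (zeroLocus_vanishingIdeal_le _)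

theorem IsIrreducibleAlgebraicSet.isPrime_vanishingIdeal {X : Set (σ → ℂ)}
    (h : IsIrreducibleAlgebraicSet X) : (vanishingIdeal ℂ X).IsPrime := by
  obtain ⟨-, ⟨x, hx⟩, hirr⟩ := h
  refine ⟨fun htop => ?_, fun {p q} hpq => ?_⟩
  · have : (1 : MvPolynomial σ ℂ) ∈ vanishingIdeal ℂ X := htop ▸ Submodule.mem_top
    simpa using this x hx
  · refine (hirr (zeroLocus ℂ (Ideal.span {p})) (zeroLocus ℂ (Ideal.span {q})) ⟨_, rfl⟩ ⟨_, rfl⟩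
      fun x hx => ?_).imp (fun hp x hx => ?_) fun hq x hx => ?_
    · have := hpq x hx
      rw [map_mul, mul_eq_zero] at this
      rw [zeroLocus_span, zeroLocus_span]
      exact this.imp (fun h => by simpa using h) fun h => by simpa using h
    · exact hp hx p (Ideal.mem_span_singleton_self p)
    · exact hq hx q (Ideal.mem_span_singleton_self q)

theorem exists_minimalPrimes_mem_zeroLocus {X : Set (σ → ℂ)} {x : σ → ℂ} (hx : x ∈ X) :
    ∃ P ∈ (vanishingIdeal ℂ X).minimalPrimes, x ∈ zeroLocus ℂ P := by
  obtain ⟨P, hP, hPx⟩ := Ideal.exists_minimalPrimes_le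
    (vanishingIdeal_anti_mono (k := ℂ) (Set.singleton_subset_iff.2 hx))
  exact ⟨P, hP, fun p hp => hPx hp x rfl⟩

variable [Finite σ]

theorem isIrreducibleAlgebraicSet_zeroLocus (P : Ideal (MvPolynomial σ ℂ)) [hP : P.IsPrime] :
    IsIrreducibleAlgebraicSet (zeroLocus ℂ P) := by
  refine ⟨⟨P, rfl⟩, Set.nonempty_iff_ne_empty.2 fun he => hP.ne_top ?_, fun B C hB hC hBC => ?_⟩
  · rw [← IsPrime.vanishingIdeal_zeroLocus (K := ℂ) P, he, vanishingIdeal_empty]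
  · by_contra! hne
    obtain ⟨⟨x, hx, hxB⟩, ⟨y, hy, hyC⟩⟩ := hne.imp Set.not_subset.1 Set.not_subset.1
    obtain ⟨I, rfl⟩ := hB
    obtain ⟨I', rfl⟩ := hC
    simp only [mem_zeroLocus_iff, not_forall] at hxB hyC
    obtain ⟨p, hp, hpx⟩ := hxB
    obtain ⟨q, hq, hqy⟩ := hyC
    have hpq : p * q ∈ P := by
      rw [← IsPrime.vanishingIdeal_zeroLocus (K := ℂ) P]
      intro z hz
      rcases hBC hz with h | h
      · rw [map_mul, h p hp, zero_mul]
      · rw [map_mul, h q hq, mul_zero]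
    rcases hP.mem_or_mem hpq with h | h
    · exact hpx (hx p h)
    · exact hqy (hy q h)

/-- Larger irreducible sets inside `X` correspond to smaller primes containing the ideal of `X`, so
minimality of `P` gives maximality. -/
theorem isIrredComponent_zeroLocus {X : Set (σ → ℂ)} (hX : IsAlgebraicSet X)
    {P : Ideal (MvPolynomial σ ℂ)} (hP : P ∈ (vanishingIdeal ℂ X).minimalPrimes) :
    IsIrredComponent (zeroLocus ℂ P) X := by
  have := hP.1.1
  refine ⟨isIrreducibleAlgebraicSet_zeroLocus P, ?_, fun Y hY hPY hYX => ?_⟩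
  · exact (zeroLocus_anti_mono hP.1.2).trans hX.zeroLocus_vanishingIdeal.le
  · have h1 : vanishingIdeal ℂ Y ≤ P := by
      simpa using vanishingIdeal_anti_mono (k := ℂ) hPY
    have h2 := hP.2 ⟨hY.isPrime_vanishingIdeal, vanishingIdeal_anti_mono hYX⟩ h1
    rw [← hY.1.zeroLocus_vanishingIdeal, le_antisymm h1 h2]

end Components

/-! ### Generic slices -/

section Slices

variable {n D : ℕ}

theorem eval_slice (c : SliceVar n D → ℂ) (l : Fin D) (x : Fin n → ℂ) :
    eval x (slice c l) = (∑ t, c (l, some t) * x t) + c (l, none) := by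
  simp [slice]

theorem generic_eval_slice_ne_zero (x : Fin n → ℂ) (l : Fin D) :
    Generic fun c : SliceVar n D → ℂ => eval x (slice c l) ≠ 0 := by
  let g : MvPolynomial (SliceVar n D) ℂ := (∑ t, X (l, some t) * C (x t)) + X (l, none)
  have hg : ∀ c, eval c g = eval x (slice c l) := fun c => by simp [g, eval_slice]
  -- At zero linear part and constant term 1 the slice takes the value 1.
  have hne : g ≠ 0 := fun h0 => by
    have := hg fun v => if v.2 = none then 1 else 0
    simp [h0, eval_slice] at this
  exact (generic_eval_ne_zero hne).mono fun c hc => hg c ▸ hc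

/-- The coefficients of a slicing system: the matrix and the constant terms. -/
def sliceVarEquiv (n D : ℕ) : (Fin D × Fin n) ⊕ Fin D ≃ SliceVar n D where
  toFun := Sum.elim (fun v => (v.1, some v.2)) fun l => (l, none)
  invFun v := v.2.elim (Sum.inr v.1) fun t => Sum.inl (v.1, t)
  left_inv := by rintro (v | l) <;> rfl
  right_inv := by rintro ⟨l, _ | t⟩ <;> rfl

theorem isConstructibleSet_slice_eq_zero {σ : Type*} (φ : SliceVar n D → σ) (ψ : Fin n → σ)
    (l : Fin D) : IsConstructibleSet {w : σ → ℂ |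
      eval (fun t => w (ψ t)) (slice (fun v => w (φ v)) l) = 0} := by
  convert IsConstructibleSet.zeros
    ((∑ t, X (φ (l, some t)) * X (ψ t)) + X (φ (l, none)) : MvPolynomial σ ℂ) using 3
  simp [eval_slice]

/-- If generic slices meet `S`, fix a generic matrix `M` of linear coefficients. Then the `D` linear
forms given by `-M` take generic values `b` on `S`, which forces dimension at least `D`. -/
theorem generic_disjoint_sliceZeros {S : Set (Fin n → ℂ)} (hS : IsConstructibleSet S)
    (hdim : ¬ (D : WithBot ℕ∞) ≤ algDim S) :
    Generic fun c : SliceVar n D → ℂ => ¬ ∃ x, x ∈ S ∧ x ∈ sliceZeros c := by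
  have hcons : IsConstructibleSet {c : SliceVar n D → ℂ | ∃ x, x ∈ S ∧ x ∈ sliceZeros c} :=
    .exists_right (P := fun (c : SliceVar n D → ℂ) x => x ∈ S ∧ x ∈ sliceZeros c)
      (.and (hS.comp Sum.inr)
        (.forall_finite fun l => isConstructibleSet_slice_eq_zero Sum.inl Sum.inr l))
  refine hcons.generic_not_iff.2 fun hgen => hdim ?_
  have h2 := (hcons.comp (sliceVarEquiv n D).symm).generic_mem_iff.1
    ((Generic.comp_equiv_iff (sliceVarEquiv n D).symm).2 hgen)
  obtain ⟨M, hM⟩ := h2.exists_point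
  refine natCast_le_algDim_of_generic (fun l => -∑ t, C (M (l, t)) * X t) (hM.mono ?_)
  rintro b ⟨x, hx, hxb⟩
  refine ⟨x, hx, fun l => ?_⟩
  have := hxb l
  rw [eval_slice] at this
  simp only [sliceVarEquiv] at this
  simpa [neg_eq_iff_add_eq_zero] using! this

theorem generic_mem_partOfDimGE {X : Set (Fin n → ℂ)} (hX : IsAlgebraicSet X) :
    Generic fun c : SliceVar n D → ℂ => ∀ x ∈ X, x ∈ sliceZeros c → x ∈ partOfDimGE D X := by
  have hfin : Finite (vanishingIdeal ℂ X).minimalPrimes :=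
    (Ideal.finite_minimalPrimes_of_isNoetherianRing _ _).to_subtype
  have h : ∀ P : (vanishingIdeal ℂ X).minimalPrimes, Generic fun c : SliceVar n D → ℂ =>
      ∀ x ∈ zeroLocus ℂ P.1, x ∈ sliceZeros c → x ∈ partOfDimGE D X := by
    intro P
    by_cases hP : (D : WithBot ℕ∞) ≤ algDim (zeroLocus ℂ P.1)
    · exact .of_forall fun c x hx _ => ⟨_, isIrredComponent_zeroLocus hX P.2, hP, hx⟩
    · exact (generic_disjoint_sliceZeros (IsAlgebraicSet.isConstructibleSet ⟨P.1, rfl⟩) hP).mono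
        fun c hc x hx hxc => absurd ⟨x, hx, hxc⟩ hc
  refine (Generic.forall_finite h).mono fun c hc x hx hxc => ?_
  obtain ⟨P, hP, hxP⟩ := exists_minimalPrimes_mem_zeroLocus hx
  exact hc ⟨P, hP⟩ x hxP hxc

theorem hasWitnessPoints_of_generic {d : ℕ} (hd : 1 ≤ d) {X : Set (Fin n → ℂ)}
    (hX : IsAlgebraicSet X)
    (h : Generic fun c : SliceVar n D → ℂ => ∃ x : Fin d → Fin n → ℂ, Function.Injective x ∧
      ∀ i, x i ∈ X ∧ x i ∈ sliceZeros c) : HasWitnessPoints D d X := by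
  -- Since `d ≥ 1`, the slice has at least one point, and the component through it already gives the
  -- bound on the dimension.
  have h' := h.and (generic_mem_partOfDimGE hX)
  constructor
  · obtain ⟨c, ⟨x, -, hx⟩, hpart⟩ := h'.exists_point
    obtain ⟨Y, hY, hdim, -⟩ := hpart _ (hx ⟨0, hd⟩).1 (hx ⟨0, hd⟩).2
    exact hdim.trans (algDim_mono hY.2.1)
  · refine h'.mono ?_
    rintro c ⟨⟨x, hinj, hx⟩, hpart⟩
    calc (d : ℕ∞) = (Set.range x).encard := by
          rw [← Set.image_univ, hinj.encard_image, Set.encard_univ]; simp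
      _ ≤ _ := Set.encard_le_encard (by
          rintro _ ⟨i, rfl⟩
          exact ⟨hpart _ (hx i).1 (hx i).2, (hx i).2⟩)

end Slices

theorem withBot_enat_le_of_forall_natCast_le {x y : WithBot ℕ∞}
    (h : ∀ r : ℕ, (r : WithBot ℕ∞) ≤ x → (r : WithBot ℕ∞) ≤ y) : x ≤ y := by
  induction x with
  | bot => exact bot_le
  | coe x =>
    induction x with
    | top =>
      induction y with
      | bot => simpa using h 0 le_top
      | coe y =>
        refine WithBot.coe_le_coe.2 (top_le_iff.2 (ENat.eq_top_iff_forall_ge.2 fun r => ?_))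
        exact WithBot.coe_le_coe.1 (h r (WithBot.coe_le_coe.2 le_top))
    | coe r => exact h r le_rfl

/-! ### The fiber product systems -/

section FiberProduct

variable {n m k D d : ℕ} {f : Fin k → MvPolynomial (Fin n ⊕ Fin m) ℂ}
  {A : Set (Fin n ⊕ Fin m → ℂ)}
  {Δ : (a : ℕ) → (Fin a × SliceVar n D → ℂ) → Set (TupleVar n m d a → ℂ)}

/-- The point `x_{ji}` of a tuple. -/
def tuplePoint {a : ℕ} (z : TupleVar n m d a → ℂ) (j : Fin a) (i : Fin d) : Fin n → ℂ :=
  fun t => z (Sum.inl (j, i, t))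

theorem mem_fiberZeros_iff {a : ℕ} {c : Fin a × SliceVar n D → ℂ} {z : TupleVar n m d a → ℂ} :
    z ∈ fiberZeros d f a c ↔ ∀ j i,
      (∀ s, eval (fun v => z (Sum.map (fun t => (j, i, t)) id v)) (f s) = 0) ∧
      tuplePoint z j i ∈ sliceZeros fun v => c (j, v) := by
  have h1 : ∀ j i s, eval z (fiberSystem d f a c (j, i, Sum.inl s)) =
      eval (fun v => z (Sum.map (fun t => (j, i, t)) id v)) (f s) := fun j i s => by
    simp only [fiberSystem, componentSystem, eval_rename]
    congr 2
    ext (t | q) <;> rfl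
  have h2 : ∀ j i l, eval z (fiberSystem d f a c (j, i, Sum.inr l)) =
      eval (tuplePoint z j i) (slice (fun v => c (j, v)) l) := fun j i l => by
    simp only [fiberSystem, componentSystem, eval_rename]
    rfl
  simp only [fiberZeros, Set.mem_ofPred_eq, Prod.forall, Sum.forall, h1, h2, sliceZeros]

theorem mem_fiberZerosIn_iff (hAf : ∀ z ∈ A, ∀ s, eval z (f s) = 0) {a : ℕ}
    {c : Fin a × SliceVar n D → ℂ} {z : TupleVar n m d a → ℂ} :
    z ∈ fiberZerosIn d f A a c ↔ ∀ j i,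
      (fun v => z (Sum.map (fun t => (j, i, t)) id v)) ∈ A ∧
      tuplePoint z j i ∈ sliceZeros fun v => c (j, v) := by
  rw [fiberZerosIn, Set.mem_ofPred_eq, mem_fiberZeros_iff]
  exact ⟨fun h j i => ⟨h.2 j i, (h.1 j i).2⟩,
    fun h => ⟨fun j i => ⟨hAf _ (h j i).1, (h j i).2⟩, fun j i => (h j i).1⟩⟩

theorem mem_exceptionalSet_iff {a : ℕ} {c : Fin a × SliceVar n D → ℂ} {p : Fin m → ℂ} :
    p ∈ exceptionalSet d f A Δ a c ↔
      ∃ x, Sum.elim x p ∈ fiberZerosIn d f A a c ∧ Sum.elim x p ∉ Δ a c := by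
  constructor
  · rintro ⟨z, hz, rfl⟩
    have : Sum.elim (z ∘ Sum.inl) (toParam z) = z := Sum.elim_comp_inl_inr z
    exact ⟨z ∘ Sum.inl, by rw [this]; exact hz⟩
  · rintro ⟨x, hx⟩
    exact ⟨_, hx, rfl⟩

theorem isConstructibleSet_exceptionalSet (hA : IsAlgebraicSet A)
    (hAf : ∀ z ∈ A, ∀ s, eval z (f s) = 0) (hΔ : IsIgnorable d f Δ) (a : ℕ) :
    IsConstructibleSet {w : (Fin a × SliceVar n D) ⊕ Fin m → ℂ |
      w ∘ Sum.inr ∈ exceptionalSet d f A Δ a (w ∘ Sum.inl)} := by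
  have h1 : IsConstructibleSet {w : (Fin a × SliceVar n D) ⊕ TupleVar n m d a → ℂ |
      (fun v => w (Sum.inr v)) ∈ fiberZerosIn d f A a (fun v => w (Sum.inl v)) ∧
      (fun v => w (Sum.inr v)) ∉ Δ a (fun v => w (Sum.inl v))} := by
    refine .and ?_ (hΔ.algebraic a).isConstructibleSet.not
    simp only [mem_fiberZerosIn_iff hAf]
    refine .forall_finite fun j => .forall_finite fun i => .and ?_ (.forall_finite fun l => ?_)
    · exact hA.isConstructibleSet.comp fun v => Sum.inr (Sum.map (fun t => (j, i, t)) id v)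
    · exact isConstructibleSet_slice_eq_zero (fun v => Sum.inl (j, v))
        (fun t => Sum.inr (Sum.inl (j, i, t))) l
  simp only [mem_exceptionalSet_iff]
  refine .exists_right (P := fun (w : (Fin a × SliceVar n D) ⊕ Fin m → ℂ) x =>
    Sum.elim x (w ∘ Sum.inr) ∈ fiberZerosIn d f A a (w ∘ Sum.inl) ∧
      Sum.elim x (w ∘ Sum.inr) ∉ Δ a (w ∘ Sum.inl)) ?_
  convert h1.comp (Sum.elim (Sum.inl ∘ Sum.inl) (Sum.elim Sum.inr (Sum.inl ∘ Sum.inr))) using 3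
    with w
  have : Sum.elim (w ∘ Sum.inr) ((w ∘ Sum.inl) ∘ Sum.inr) = fun v => w
      (Sum.elim Sum.inr (Sum.inl ∘ Sum.inr) v) := by
    ext (v | v) <;> rfl
  rw [this]
  rfl

/-- The constants of `a + 1` copies, split into those of the first `a` copies and of the last. -/
def constEquiv (n D a : ℕ) :
    (Fin a × SliceVar n D) ⊕ (Fin 1 × SliceVar n D) ≃ Fin (a + 1) × SliceVar n D :=
  (Equiv.sumProdDistrib (Fin a) (Fin 1) (SliceVar n D)).symm.trans
    (finSumFinEquiv.prodCongr (Equiv.refl _))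

/-- The constants of `a + 1` copies, given those of the first `a` copies and of the last. -/
def joinConst {a : ℕ} (c : Fin a × SliceVar n D → ℂ) (c' : Fin 1 × SliceVar n D → ℂ) :
    Fin (a + 1) × SliceVar n D → ℂ :=
  fun v => Sum.elim c c' ((constEquiv n D a).symm v)

theorem constEquiv_symm_castSucc {a : ℕ} (j : Fin a) (v : SliceVar n D) :
    (constEquiv n D a).symm (j.castSucc, v) = Sum.inl (j, v) := by
  rw [Equiv.symm_apply_eq]; rfl

theorem constEquiv_symm_last {a : ℕ} (v : SliceVar n D) :
    (constEquiv n D a).symm (Fin.last a, v) = Sum.inr (0, v) := by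
  rw [Equiv.symm_apply_eq]; rfl

theorem joinConst_castSucc {a : ℕ} (c : Fin a × SliceVar n D → ℂ)
    (c' : Fin 1 × SliceVar n D → ℂ) (j : Fin a) (v : SliceVar n D) :
    joinConst c c' (j.castSucc, v) = c (j, v) := by
  simp [joinConst, constEquiv_symm_castSucc]

theorem joinConst_last {a : ℕ} (c : Fin a × SliceVar n D → ℂ)
    (c' : Fin 1 × SliceVar n D → ℂ) (v : SliceVar n D) :
    joinConst c c' (Fin.last a, v) = c' (0, v) := by
  simp [joinConst, constEquiv_symm_last]

theorem subConst_castSucc_joinConst {a : ℕ} (c : Fin a × SliceVar n D → ℂ)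
    (c' : Fin 1 × SliceVar n D → ℂ) : subConst Fin.castSucc (joinConst c c') = c :=
  funext fun ⟨j, v⟩ => joinConst_castSucc c c' j v

theorem subConst_last_joinConst {a : ℕ} (c : Fin a × SliceVar n D → ℂ)
    (c' : Fin 1 × SliceVar n D → ℂ) :
    subConst (fun _ : Fin 1 => Fin.last a) (joinConst c c') = c' :=
  funext fun ⟨j, v⟩ => by rw [Subsingleton.elim j 0]; exact joinConst_last c c' v

theorem generic_joinConst_iff {a : ℕ} {P : (Fin (a + 1) × SliceVar n D → ℂ) → Prop}
    (h : IsConstructibleSet {c | P c}) :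
    Generic P ↔ Generic fun c : Fin a × SliceVar n D → ℂ =>
      Generic fun c' : Fin 1 × SliceVar n D → ℂ => P (joinConst c c') := by
  refine (Generic.comp_equiv_iff (constEquiv n D a).symm).symm.trans ?_
  exact (h.comp (constEquiv n D a).symm).generic_mem_iff

theorem generic_joinConst {a : ℕ} {P : (Fin a × SliceVar n D → ℂ) → Prop} (h : Generic P) :
    Generic fun c : Fin (a + 1) × SliceVar n D → ℂ => P (subConst Fin.castSucc c) :=
  h.comp_injective (φ := Prod.map Fin.castSucc id)
    (Function.Injective.prodMap (Fin.castSucc_injective a) Function.injective_id)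

theorem subTuple_mem_fiberZerosIn (hAf : ∀ z ∈ A, ∀ s, eval z (f s) = 0) {a b : ℕ}
    (φ : Fin a → Fin b) {c : Fin b × SliceVar n D → ℂ} {z : TupleVar n m d b → ℂ}
    (hz : z ∈ fiberZerosIn d f A b c) : subTuple φ z ∈ fiberZerosIn d f A a (subConst φ c) := by
  rw [mem_fiberZerosIn_iff hAf] at hz ⊢
  intro j i
  refine ⟨?_, (hz (φ j) i).2⟩
  convert (hz (φ j) i).1 using 2 with v
  rcases v with t | q <;> rfl

theorem exceptionalSet_subset_subConst (hAf : ∀ z ∈ A, ∀ s, eval z (f s) = 0)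
    (hΔ : IsIgnorable d f Δ) {a b : ℕ} (φ : Fin a ↪o Fin b) (c : Fin b × SliceVar n D → ℂ) :
    exceptionalSet d f A Δ b c ⊆ exceptionalSet d f A Δ a (subConst φ c) := by
  rintro _ ⟨z, ⟨hz, hzΔ⟩, rfl⟩
  exact ⟨subTuple φ z, ⟨subTuple_mem_fiberZerosIn hAf φ hz,
    fun h => hzΔ (hΔ.natural φ c z hz.1 h)⟩, rfl⟩

theorem exceptionalSet_subset_castSucc (hAf : ∀ z ∈ A, ∀ s, eval z (f s) = 0)
    (hΔ : IsIgnorable d f Δ) {a : ℕ} (c : Fin (a + 1) × SliceVar n D → ℂ) :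
    exceptionalSet d f A Δ (a + 1) c ⊆ exceptionalSet d f A Δ a (subConst Fin.castSucc c) :=
  exceptionalSet_subset_subConst hAf hΔ Fin.castSuccOrderEmb c

theorem exceptionalSet_subset_last (hAf : ∀ z ∈ A, ∀ s, eval z (f s) = 0)
    (hΔ : IsIgnorable d f Δ) {a : ℕ} (c : Fin (a + 1) × SliceVar n D → ℂ) :
    exceptionalSet d f A Δ (a + 1) c ⊆
      exceptionalSet d f A Δ 1 (subConst (fun _ => Fin.last a) c) :=
  exceptionalSet_subset_subConst hAf hΔ
    (OrderEmbedding.ofStrictMono (fun _ : Fin 1 => Fin.last a) fun i j hij =>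
      absurd hij (by simp [Subsingleton.elim i j])) c

/-- The parameters which are exceptional for a single copy with generic constants. -/
def genericExceptionalSet (d : ℕ) (f : Fin k → MvPolynomial (Fin n ⊕ Fin m) ℂ)
    (A : Set (Fin n ⊕ Fin m → ℂ))
    (Δ : (a : ℕ) → (Fin a × SliceVar n D → ℂ) → Set (TupleVar n m d a → ℂ)) :
    Set (Fin m → ℂ) :=
  {p | Generic fun c : Fin 1 × SliceVar n D → ℂ => p ∈ exceptionalSet d f A Δ 1 c}

theorem isConstructibleSet_genericExceptionalSet (hA : IsAlgebraicSet A)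
    (hAf : ∀ z ∈ A, ∀ s, eval z (f s) = 0) (hΔ : IsIgnorable d f Δ) :
    IsConstructibleSet (genericExceptionalSet d f A Δ) :=
  .generic_right (P := fun p c => p ∈ exceptionalSet d f A Δ 1 c)
    ((isConstructibleSet_exceptionalSet hA hAf hΔ 1).comp (Equiv.sumComm _ _))

/-- A solution over `p` for the new constants is appended to the given one. By consistency the
result can be ignored only if the new copy repeats an old one, and generic slices prevent that. -/
theorem generic_mem_exceptionalSet_joinConst (hd : 1 ≤ d)
    (hAf : ∀ z ∈ A, ∀ s, eval z (f s) = 0) (hΔ : IsIgnorable d f Δ) {a : ℕ}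
    {c : Fin a × SliceVar n D → ℂ} {p : Fin m → ℂ} (hp : p ∈ exceptionalSet d f A Δ a c)
    (hp' : p ∈ genericExceptionalSet d f A Δ) :
    Generic fun c' : Fin 1 × SliceVar n D → ℂ =>
      p ∈ exceptionalSet d f A Δ (a + 1) (joinConst c c') := by
  obtain ⟨z, ⟨hz, hzΔ⟩, rfl⟩ := hp
  -- A repetition would put the first point of an old copy on the new slice. That point exists
  -- because `d ≥ 1`; for `D = 0` the condition is empty, and consistency then allows no repetition.
  have havoid : Generic fun c' : Fin 1 × SliceVar n D → ℂ => ∀ (j : Fin a) (l : Fin D),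
      eval (tuplePoint z j ⟨0, hd⟩) (slice (fun v => c' (0, v)) l) ≠ 0 :=
    .forall_finite fun j => .forall_finite fun l =>
      (generic_eval_slice_ne_zero (tuplePoint z j ⟨0, hd⟩) l).comp_injective
        (Prod.mk_right_injective (0 : Fin 1))
  refine (hp'.and havoid).mono ?_
  rintro c' ⟨⟨z', ⟨hz', hzΔ'⟩, hpar⟩, hc'⟩
  let w : TupleVar n m d (a + 1) → ℂ := Sum.elim
    (fun v => (Fin.lastCases (tuplePoint z' 0) (tuplePoint z) v.1 : Fin d → Fin n → ℂ) v.2.1 v.2.2)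
    (toParam z)
  have hw1 : subTuple Fin.castSucc w = z := by
    ext (v | q) <;> simp [subTuple, w, tuplePoint, toParam]
  have hw2 : subTuple (fun _ : Fin 1 => Fin.last a) w = z' := by
    ext (⟨j, v⟩ | q)
    · simp [subTuple, w, tuplePoint, Subsingleton.elim j 0]
    · exact (congrFun hpar q).symm
  have hwmem : w ∈ fiberZerosIn d f A (a + 1) (joinConst c c') := by
    rw [mem_fiberZerosIn_iff hAf] at hz hz' ⊢
    intro j i
    induction j using Fin.lastCases with
    | last =>
      simp only [joinConst_last]
      rw [← hw2] at hz'
      refine ⟨?_, (hz' 0 i).2⟩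
      convert (hz' 0 i).1 using 2 with v
      rcases v with t | q <;> rfl
    | cast j =>
      simp only [joinConst_castSucc]
      rw [← hw1] at hz
      refine ⟨?_, (hz j i).2⟩
      convert (hz j i).1 using 2 with v
      rcases v with t | q <;> rfl
  refine ⟨w, ⟨hwmem, fun hwΔ => ?_⟩, rfl⟩
  rcases hΔ.consistent a _ w hwΔ with h | h | ⟨hD, j, hj⟩
  · rw [hw1, subConst_castSucc_joinConst] at h
    exact hzΔ h
  · rw [hw2, subConst_last_joinConst] at h
    exact hzΔ' h
  · refine hc' j ⟨0, hD⟩ ?_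
    have h1 := ((mem_fiberZerosIn_iff hAf).1 hz' 0 ⟨0, hd⟩).2 ⟨0, hD⟩
    convert h1 using 2
    rw [← hw1, ← hw2]
    exact congrArg eval (funext fun t => (hj ⟨0, hd⟩ t).symm)

theorem isAlgebraicSet_fiber (hA : IsAlgebraicSet A) (p : Fin m → ℂ) :
    IsAlgebraicSet (fiber A p) := by
  obtain ⟨I, rfl⟩ := hA
  let φ : MvPolynomial (Fin n ⊕ Fin m) ℂ →ₐ[ℂ] MvPolynomial (Fin n) ℂ :=
    aeval (Sum.elim X fun q => C (p q))
  refine ⟨Ideal.span (φ '' I), ?_⟩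
  have hφ : ∀ (x : Fin n → ℂ) g, aeval x (φ g) = aeval (Sum.elim x p) g := fun x g => by
    rw [comp_aeval_apply]
    congr 1
    congr 1
    ext (t | q) <;> simp
  ext x
  simp [zeroLocus_span, fiber, ← hφ]

/-- A solution that is not ignored has `d` distinct points, all in the fiber over `p` and on one
generic slice. -/
theorem hasWitnessPoints_of_mem_genericExceptionalSet (hd : 1 ≤ d) (hA : IsAlgebraicSet A)
    (hAf : ∀ z ∈ A, ∀ s, eval z (f s) = 0) (hrep : IgnoresRepeats d f Δ) {p : Fin m → ℂ}
    (hp : p ∈ genericExceptionalSet d f A Δ) : HasWitnessPoints D d (fiber A p) := by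
  refine hasWitnessPoints_of_generic hd (isAlgebraicSet_fiber hA p) ?_
  have hgen : Generic fun c : Fin 1 × SliceVar n D → ℂ => p ∈ exceptionalSet d f A Δ 1 c := hp
  refine (hgen.comp_injective (φ := Prod.snd) ?_).mono ?_
  · rintro ⟨i, v⟩ ⟨j, v'⟩ h
    exact Prod.ext (Subsingleton.elim _ _) h
  rintro c ⟨z, ⟨hz, hzΔ⟩, rfl⟩
  refine ⟨tuplePoint z 0, fun i i' hii' => ?_, fun i => ?_⟩
  · by_contra hne
    exact hzΔ (hrep _ z hz.1 ⟨i, i', hne, congrFun hii'⟩)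
  · have h := (mem_fiberZerosIn_iff hAf).1 hz 0 i
    have hpt : Sum.elim (tuplePoint z 0 i) (toParam z) =
        fun v => z (Sum.map (fun t => (0, i, t)) id v) := by
      ext (t | q) <;> rfl
    exact ⟨show Sum.elim _ _ ∈ A from hpt ▸ h.1, h.2⟩

/-! ### Dimensions of the exceptional sets for generic constants -/

variable (hA : IsAlgebraicSet A) (hAf : ∀ z ∈ A, ∀ s, eval z (f s) = 0) (hΔ : IsIgnorable d f Δ)
include hA hAf hΔ

theorem isConstructibleSet_exceptionalSet_fiber {a : ℕ} (c : Fin a × SliceVar n D → ℂ) :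
    IsConstructibleSet (exceptionalSet d f A Δ a c) :=
  (isConstructibleSet_exceptionalSet hA hAf hΔ a).fiber_right_mem c

theorem exists_generic_algDim_exceptionalSet_eq (a : ℕ) :
    ∃ e : WithBot ℕ∞, Generic fun c : Fin a × SliceVar n D → ℂ =>
      algDim (exceptionalSet d f A Δ a c) = e := by
  -- Each bound "dimension at least `r`" is a constructible condition on `c`, so generically it has
  -- a constant truth value. Only the `m + 1` values `r ≤ m` matter inside ℂᵐ.
  have h : ∀ r : Fin (m + 1), ∃ b : Prop, Generic fun c : Fin a × SliceVar n D → ℂ =>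
      HasGenericProjection r (exceptionalSet d f A Δ a c) ↔ b := fun r => by
    rcases (IsConstructibleSet.hasGenericProjection (P := fun c p => p ∈ exceptionalSet d f A Δ a c)
      (isConstructibleSet_exceptionalSet hA hAf hΔ a) r).generic_or with h | h
    · exact ⟨True, h.mono fun c hc => iff_true_intro hc⟩
    · exact ⟨False, h.mono fun c hc => iff_false_intro hc⟩
  choose b hb using h
  have hall := Generic.forall_finite hb
  obtain ⟨c₀, hc₀⟩ := hall.exists_point
  refine ⟨algDim (exceptionalSet d f A Δ a c₀), hall.mono fun c hc => ?_⟩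
  have hcast : ∀ r : ℕ, (r : WithBot ℕ∞) ≤ algDim (exceptionalSet d f A Δ a c) ↔
      (r : WithBot ℕ∞) ≤ algDim (exceptionalSet d f A Δ a c₀) := fun r => by
    rw [natCast_le_algDim_iff (isConstructibleSet_exceptionalSet_fiber hA hAf hΔ c),
      natCast_le_algDim_iff (isConstructibleSet_exceptionalSet_fiber hA hAf hΔ c₀)]
    by_cases hr : r < m + 1
    · exact (hc ⟨r, hr⟩).trans (hc₀ ⟨r, hr⟩).symm
    · have : ∀ S : Set (Fin m → ℂ), ¬ HasGenericProjection r S := fun S ⟨J, _⟩ => hr (by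
        have := J.1.card_le_univ
        rw [J.2, Fintype.card_fin] at this
        omega)
      exact iff_of_false (this _) (this _)
  exact le_antisymm (withBot_enat_le_of_forall_natCast_le fun r => (hcast r).1)
    (withBot_enat_le_of_forall_natCast_le fun r => (hcast r).2)

theorem algDim_exceptionalSet_generic_iff {a : ℕ} {e : WithBot ℕ∞}
    (he : Generic fun c : Fin a × SliceVar n D → ℂ => algDim (exceptionalSet d f A Δ a c) = e)
    (r : ℕ) : (r : WithBot ℕ∞) ≤ e ↔ Generic fun c : Fin a × SliceVar n D → ℂ =>
      HasGenericProjection r (exceptionalSet d f A Δ a c) := by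
  have hcons := isConstructibleSet_exceptionalSet_fiber hA hAf hΔ (a := a)
  constructor
  · exact fun hr => he.mono fun c hc => (natCast_le_algDim_iff (hcons c)).1 (hc ▸ hr)
  · intro h
    obtain ⟨c, hc, hce⟩ := (h.and he).exists_point
    exact hce ▸ (natCast_le_algDim_iff (hcons c)).2 hc

theorem isConstructibleSet_exceptionalSet_joinConst (a : ℕ) (c : Fin a × SliceVar n D → ℂ) :
    IsConstructibleSet {w : (Fin 1 × SliceVar n D) ⊕ Fin m → ℂ |
      w ∘ Sum.inr ∈ exceptionalSet d f A Δ (a + 1) (joinConst c (w ∘ Sum.inl))} := by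
  have h := (isConstructibleSet_exceptionalSet hA hAf hΔ (a + 1)).preimage
    (τ := (Fin 1 × SliceVar n D) ⊕ Fin m)
    (Sum.elim (fun v => Sum.elim (fun u => C (c u)) (fun u => X (Sum.inl u))
      ((constEquiv n D a).symm v)) fun q => X (Sum.inr q))
  refine Eq.mp (congrArg IsConstructibleSet (Set.ext fun w => ?_)) h
  have h1 : (fun v => eval w (Sum.elim (fun u => C (c u)) (fun u => X (Sum.inl u))
      ((constEquiv n D a).symm v) : MvPolynomial ((Fin 1 × SliceVar n D) ⊕ Fin m) ℂ)) =
      joinConst c (w ∘ Sum.inl) := funext fun v => by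
    simp only [joinConst]
    rcases (constEquiv n D a).symm v with u | u <;> simp
  have h2 : (fun q => eval w (X (Sum.inr q) :
      MvPolynomial ((Fin 1 × SliceVar n D) ⊕ Fin m) ℂ)) = w ∘ Sum.inr := funext fun q => by
    simp
  change _ ↔ w ∘ Sum.inr ∈ exceptionalSet d f A Δ (a + 1) (joinConst c (w ∘ Sum.inl))
  rw [← h1, ← h2]
  rfl

/-- If appending a copy does not lower the dimension below `r`, then the parameters which are
exceptional for generic constants already have dimension `r`. -/
theorem generic_hasGenericProjection_inter {a r : ℕ}
    (hr : Generic fun c : Fin a × SliceVar n D → ℂ =>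
      ¬ HasGenericProjection (r + 1) (exceptionalSet d f A Δ a c))
    {Q : Set (Fin m → ℂ)} (hQ : IsConstructibleSet Q)
    (h : Generic fun c : Fin (a + 1) × SliceVar n D → ℂ =>
      HasGenericProjection r {p | p ∈ exceptionalSet d f A Δ (a + 1) c ∧ p ∈ Q}) :
    Generic fun c : Fin a × SliceVar n D → ℂ => HasGenericProjection r
      {p | (p ∈ exceptionalSet d f A Δ a c ∧ p ∈ genericExceptionalSet d f A Δ) ∧ p ∈ Q} := by
  have hcons : IsConstructibleSet {c : Fin (a + 1) × SliceVar n D → ℂ |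
      HasGenericProjection r {p | p ∈ exceptionalSet d f A Δ (a + 1) c ∧ p ∈ Q}} :=
    .hasGenericProjection (P := fun c p => p ∈ exceptionalSet d f A Δ (a + 1) c ∧ p ∈ Q)
      ((isConstructibleSet_exceptionalSet hA hAf hΔ (a + 1)).and (hQ.comp Sum.inr)) r
  refine (hr.and ((generic_joinConst_iff hcons).1 h)).mono ?_
  rintro c ⟨hc, hc'⟩
  have hsub : ∀ c' p, p ∈ exceptionalSet d f A Δ (a + 1) (joinConst c c') ∧ p ∈ Q →
      p ∈ exceptionalSet d f A Δ a c := fun c' p hp => by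
    simpa [subConst_castSucc_joinConst] using exceptionalSet_subset_castSucc hAf hΔ _ hp.1
  -- The first `a` constants are now fixed; the sets varying with `c'` lie in the fixed set for `c`,
  -- whose dimension is at most `r`.
  have hmem := HasGenericProjection.generic_mem
    (P := fun c' p => p ∈ exceptionalSet d f A Δ (a + 1) (joinConst c c') ∧ p ∈ Q)
    ((isConstructibleSet_exceptionalSet_joinConst hA hAf hΔ a c).and (hQ.comp Sum.inr))
    (isConstructibleSet_exceptionalSet_fiber hA hAf hΔ c) hc hsub hc'
  refine hmem.mono fun p hp => ⟨⟨?_, hp.mono fun c' hc' => ?_⟩, ?_⟩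
  · obtain ⟨c', hc'⟩ := hp.exists_point
    exact hsub c' p hc'
  -- Keeping only the last copy shows that `p` is exceptional for the single constants `c'`, which
  -- are generic.
  · simpa [subConst_last_joinConst] using exceptionalSet_subset_last hAf hΔ _ hc'.1
  · obtain ⟨c', hc'⟩ := hp.exists_point
    exact hc'.2

/-- Each point of the intersection survives for generic `c'`; exchanging the generic quantifiers
over `c'` and over the projected coordinates makes the projection generic for generic `c'`. -/
theorem generic_hasGenericProjection_succ (hd : 1 ≤ d) {a r : ℕ}
    (h : Generic fun c : Fin a × SliceVar n D → ℂ => HasGenericProjection r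
      {p | p ∈ exceptionalSet d f A Δ a c ∧ p ∈ genericExceptionalSet d f A Δ}) :
    Generic fun c : Fin (a + 1) × SliceVar n D → ℂ => HasGenericProjection r
      {p | p ∈ exceptionalSet d f A Δ (a + 1) c ∧ p ∈ genericExceptionalSet d f A Δ} := by
  have hG := isConstructibleSet_genericExceptionalSet hA hAf hΔ
  refine (generic_joinConst_iff (.hasGenericProjection
    (P := fun c p => p ∈ exceptionalSet d f A Δ (a + 1) c ∧ p ∈ genericExceptionalSet d f A Δ)
      ((isConstructibleSet_exceptionalSet hA hAf hΔ (a + 1)).and (hG.comp Sum.inr)) r)).2 ?_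
  refine h.mono fun c hc => generic_hasGenericProjection (P := fun c' p =>
    p ∈ exceptionalSet d f A Δ (a + 1) (joinConst c c') ∧ p ∈ genericExceptionalSet d f A Δ)
    ((isConstructibleSet_exceptionalSet_joinConst hA hAf hΔ a c).and (hG.comp Sum.inr)) ?_
  exact hc.mono fun p hp => (generic_mem_exceptionalSet_joinConst hd hAf hΔ hp.1 hp.2).mono
    fun c' hc' => ⟨hc', hp.2⟩

end FiberProduct

theorem exists_natCast_eq_of_algDim {σ : Type*} [Finite σ] {S : Set (σ → ℂ)}
    (h : algDim S ≠ ⊥) : ∃ r : ℕ, algDim S = r := by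
  have hle : algDim S ≤ Nat.card σ := by
    have := ringKrullDim_quotient_le (vanishingIdeal ℂ S)
    rwa [MvPolynomial.ringKrullDim_of_isNoetherianRing, ringKrullDim_eq_zero_of_field,
      zero_add] at this
  obtain ⟨x, hx⟩ := WithBot.ne_bot_iff_exists.1 h
  rw [← hx] at hle ⊢
  have hne : x ≠ ⊤ := fun ht => by
    rw [ht] at hle
    exact absurd (WithBot.coe_le_coe.1 hle) (by simp)
  obtain ⟨r, rfl⟩ := ENat.ne_top_iff_exists.1 hne
  exact ⟨r, rfl⟩

end FiberProd

end

/-! ### The main theorem -/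

theorem corollary4 {n m k D d : ℕ} (hd : 1 ≤ d)
    (f : Fin k → MvPolynomial (Fin n ⊕ Fin m) ℂ)
    (A : Set (Fin n ⊕ Fin m → ℂ)) (hA : FiberProd.IsIrreducibleAlgebraicSet A)
    (hAf : ∀ z ∈ A, ∀ s, MvPolynomial.eval z (f s) = 0)
    (Δ : (a : ℕ) → (Fin a × FiberProd.SliceVar n D → ℂ) →
      Set (FiberProd.TupleVar n m d a → ℂ))
    (hΔ : FiberProd.IsIgnorable d f Δ) :
    ∃ e : ℕ → WithBot ℕ∞,
      (∀ a, FiberProd.Generic fun c : Fin a × FiberProd.SliceVar n D → ℂ =>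
        FiberProd.algDim (FiberProd.zariskiClosure (FiberProd.exceptionalSet d f A Δ a c)) =
          e a) ∧
      (∀ a, Xor (e (a + 1) < e a) (∀ j, a ≤ j → e j = e a)) ∧
      (FiberProd.IgnoresRepeats d f Δ → ∀ a, e (a + 1) = e a → e a ≠ ⊥ →
        FiberProd.Generic fun c : Fin (a + 1) × FiberProd.SliceVar n D → ℂ =>
          FiberProd.algDim (FiberProd.zariskiClosure
            {p ∈ FiberProd.exceptionalSet d f A Δ (a + 1) c |
              ¬ FiberProd.HasWitnessPoints D d (FiberProd.fiber A p)}) < e (a + 1)) := by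
  open FiberProd in
  have hcons := fun a => isConstructibleSet_exceptionalSet hA.1 hAf hΔ a
  have hG := isConstructibleSet_genericExceptionalSet hA.1 hAf hΔ
  choose e he using exists_generic_algDim_exceptionalSet_eq hA.1 hAf hΔ
  have hiff := fun a r => algDim_exceptionalSet_generic_iff hA.1 hAf hΔ (he a) r
  have hsucc : ∀ a, e (a + 1) ≤ e a := fun a => by
    obtain ⟨c, hc, hc'⟩ := ((he (a + 1)).and (generic_joinConst (he a))).exists_point
    rw [← hc, ← hc']
    exact algDim_mono (exceptionalSet_subset_castSucc hAf hΔ c)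
  have hanti : Antitone e := antitone_nat_of_succ_le hsucc
  have hnat : ∀ a, e a ≠ ⊥ → ∃ r : ℕ, e a = r := fun a ha => by
    obtain ⟨c, hc⟩ := (he a).exists_point
    rw [← hc] at ha ⊢
    exact exists_natCast_eq_of_algDim ha
  have hbound : ∀ a (r : ℕ), e a = r → Generic fun c : Fin a × SliceVar n D → ℂ =>
      ¬ HasGenericProjection (r + 1) (exceptionalSet d f A Δ a c) := fun a r hr => by
    refine ((hcons a).hasGenericProjection
      (P := fun c p => p ∈ exceptionalSet d f A Δ a c) (r + 1)).generic_not_iff.2 fun h => ?_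
    have := (hiff a (r + 1)).2 h
    rw [hr] at this
    have := Nat.cast_le.1 this
    omega
  have hstable : ∀ a, e (a + 1) = e a → ∀ j, a ≤ j → e j = e a := by
    intro a ha j hj
    by_cases hbot : e a = ⊥
    · exact le_antisymm (hanti hj) (hbot ▸ bot_le)
    obtain ⟨r, hr⟩ := hnat a hbot
    have hstart : Generic fun c : Fin a × SliceVar n D → ℂ => HasGenericProjection r
        {p | p ∈ exceptionalSet d f A Δ a c ∧ p ∈ genericExceptionalSet d f A Δ} := by
      -- Equality of the two dimensions is used only here, to enter the set of generically
      -- exceptional parameters; from then on the dimension persists by induction.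
      simpa using generic_hasGenericProjection_inter hA.1 hAf hΔ (hbound a r hr)
        (Q := Set.univ) (.const True) (by simpa using! (hiff (a + 1) r).1 (ha ▸ hr).ge)
    have hall : Generic fun c : Fin j × SliceVar n D → ℂ => HasGenericProjection r
        {p | p ∈ exceptionalSet d f A Δ j c ∧ p ∈ genericExceptionalSet d f A Δ} := by
      induction j, hj using Nat.le_induction with
      | base => exact hstart
      | succ j _ ih => exact generic_hasGenericProjection_succ hA.1 hAf hΔ hd ih
    refine le_antisymm (hanti hj) (hr ▸ (hiff j r).2 ?_)
    exact hall.mono fun c hc => hc.mono fun p hp => hp.1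
  refine ⟨e, fun a => by simpa only [algDim_zariskiClosure] using he a, fun a => ?_, ?_⟩
  · rcases (hsucc a).lt_or_eq with h | h
    · exact .inl ⟨h, fun hall => h.ne (hall (a + 1) (Nat.le_succ a))⟩
    · exact .inr ⟨hstable a h, h.not_lt⟩
  · intro hrep a ha hbot
    obtain ⟨r, hr⟩ := hnat a hbot
    have hbad : Generic fun c : Fin (a + 1) × SliceVar n D → ℂ => ¬ HasGenericProjection r
        {p | p ∈ exceptionalSet d f A Δ (a + 1) c ∧ p ∈ (genericExceptionalSet d f A Δ)ᶜ} := by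
      refine (IsConstructibleSet.hasGenericProjection (P := fun c p =>
        p ∈ exceptionalSet d f A Δ (a + 1) c ∧ p ∈ (genericExceptionalSet d f A Δ)ᶜ)
        ((hcons (a + 1)).and (hG.compl.comp Sum.inr)) r).generic_not_iff.2 fun h => ?_
      -- With `Q` the complement of the generically exceptional parameters, dimension `r` would
      -- produce a point both inside and outside that set.
      obtain ⟨c, hc⟩ := (generic_hasGenericProjection_inter hA.1 hAf hΔ (hbound a r hr)
        hG.compl h).exists_point
      obtain ⟨p, hp⟩ := hc.nonempty
      exact hp.2 hp.1.2
    refine hbad.mono fun c hc => ?_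
    rw [algDim_zariskiClosure, ha, hr, ← not_le]
    have hconsbad := (isConstructibleSet_exceptionalSet_fiber hA.1 hAf hΔ c).inter hG.compl
    refine fun hle => hc ((natCast_le_algDim_iff hconsbad).1 (hle.trans (algDim_mono ?_)))
    exact fun p hp => ⟨hp.1, fun hpG =>
      hp.2 (hasWitnessPoints_of_mem_genericExceptionalSet hd hA.1 hAf hrep hpG)⟩
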